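/- **Theorem 3.11 (Wall crossing formula).** Let $\Gamma$ be a lattice in a finite dimensional real vector space $V$ (a discrete subgroup spanning $V$) and let $X=[a_1,\dots,a_m]$ be a list of nonzero elements of $\Gamma$ spanning $V$. *Notation.* A subspace of $V$ is *rational* if it is spanned by a (possibly empty) subset of $X$; $X\cap r$ and $X\setminus r$ denote the sublists of the elements of $X$ in, respectively not in, the subspace $r$. For $f:\Gamma\to\mathbb Z$ put $(\nabla_a f)(b)=f(b)-f(b-a)$ and $\nabla_Y=\prod_{a\in Y}\nabla_a$ for a list $Y$. Let $\mathcal F(X)$ be the set of all $f:\Gamma\to\mathbb Z$ such that $\nabla_{X\setminus r}f$ is supported on $\Gamma\cap r$ for every rational subspace $r$. If a list $Y$ spans a subspace $W$, a *tope* of $Y$ in $W$ is a connected component of the complement in $W$ of the union of the hyperplanes of $W$ generated by subsets of $Y$; let $B(Y)=\{\sum_{a\in Y}t_a a: 0\le t_a\le 1\}$ and $C(Y)=\{\sum_{a\in Y}t_a a: t_a\ge 0\}$. A *quasi-polynomial* on $\Gamma\cap W$ is a $\mathbb Z$-valued function that agrees with a real polynomial on each coset of some subgroup of finite index. For a tope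 $\tau$ of $Y$ in $W$ and $g:\Gamma\to\mathbb Z$, $g^{\tau}$ denotes the quasi-polynomial on $\Gamma\cap W$ that coincides with $g$ on $\Gamma\cap(\tau-B(Y))$, extended by $0$ to $\Gamma$. For a hyperplane $H$ of $V$, let $H^\perp\subset V^*$ be the line of linear forms vanishing on $H$. For an open half-line $F\subset H^\perp$ with endpoint $0$, let $A$ and $B$ be the sublists of $X\setminus H$ of the vectors on which $F$ is positive, respectively negative, and define $\mathcal P^{F}_{X\setminus H}:\Gamma\to\mathbb Z$ by $$\sum_{\gamma\in\Gamma}\mathcal P^{F}_{X\setminus H}(\gamma)e^\gamma=(-1)^{|B|}e^{-\sum_{b\in B}b}\prod_{a\in A}\Big(\sum_{k\ge0}e^{ka}\Big)\prod_{b\in B}\Big(\sum_{k\ge0}e^{-kb}\Big).$$ The symbol $*$ denotes convolution of functions on $\Gamma$. *Statement.* Let $\tau_1,\tau_2$ be adjacent topes of $X$ in $V$, i.e. $\overline{\tau_1}\cap\overline{\tau_2}$ spans a hyperplane $H$ of $V$. Then $H$ is rational, there is a unique tope $\tau_{12}$ of $X\cap H$ in $H$ with $\overline{\tau_1}\cap\overline{\tau_2}\subset\overline{\tau_{12}}$,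 and there is a unique open half-line $F_H\subset H^\perp$ with endpoint $0$ that is positive on $\tau_1$. For every $f\in\mathcal F(X)$, the quasi-polynomials $f^{\tau_1}$, $f^{\tau_2}$ and $(\nabla_{X\setminus H}f)^{\tau_{12}}$ exist and are unique, the convolutions of $\mathcal P^{F_H}_{X\setminus H}$ and of $\mathcal P^{-F_H}_{X\setminus H}$ with $(\nabla_{X\setminus H}f)^{\tau_{12}}$ are given by finite sums at each point, and $$f^{\tau_1}-f^{\tau_2}=\big(\mathcal P^{F_H}_{X\setminus H}-\mathcal P^{-F_H}_{X\setminus H}\big)*(\nabla_{X\setminus H}f)^{\tau_{12}}.$$ If moreover the cone $C(X)$ is pointed (contains no line), let $\mathcal P_Y(\gamma)$, for a sublist $Y$ of $X$, be the number of ways of writing $\gamma=\sum_{a\in Y}k_a a$ with integers $k_a\ge0$. Then $\mathcal P_X\in\mathcal F(X)$, $\nabla_{X\setminus H}\mathcal P_X=\mathcal P_{X\cap H}$, and (Paradan's formula) $$\mathcal P_X^{\tau_1}-\mathcal P_X^{\tau_2}=\big(\mathcal P^{F_H}_{X\setminus H}-\mathcal P^{-F_H}_{X\setminus H}\big)*\mathcal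 P_{X\cap H}^{\tau_{12}}.$$ -/

import Mathlib

open scoped Pointwise

namespace WallCrossing

noncomputable section

variable {V : Type*} [NormedAddCommGroup V] [NormedSpace ℝ V] {Γ : Submodule ℤ V}

/-! Lists of lattice vectors. -/

open Classical in
/-- The sublist `Y ∩ W` of the members of `Y` lying in the subspace `W`. -/
def inside (Y : List Γ) (W : Submodule ℝ V) : List Γ :=
  Y.filter (fun a => (a : V) ∈ W)

open Classical in
/-- The sublist `Y ∖ W` of the members of `Y` not lying in the subspace `W`. -/
def outside (Y : List Γ) (W : Submodule ℝ V) : List Γ :=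
  Y.filter (fun a => (a : V) ∉ W)

/-- A subspace is rational relative to `Y` if it is spanned by a subset of the elements of `Y`
(the empty subset is allowed). -/
def IsRational (Y : List Γ) (W : Submodule ℝ V) : Prop :=
  ∃ S : Set Γ, (∀ a ∈ S, a ∈ Y) ∧ W = Submodule.span ℝ ((fun a : Γ => (a : V)) '' S)

/-- The zonotope `B(Y) = {∑ tᵢ aᵢ : 0 ≤ tᵢ ≤ 1}`. -/
def zonotope (Y : List Γ) : Set V :=
  {v | ∃ t : Fin Y.length → ℝ, (∀ i, 0 ≤ t i ∧ t i ≤ 1) ∧ v = ∑ i, t i • (Y.get i : V)}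

/-- The cone `C(Y) = {∑ tᵢ aᵢ : 0 ≤ tᵢ}`. -/
def cone (Y : List Γ) : Set V :=
  {v | ∃ t : Fin Y.length → ℝ, (∀ i, 0 ≤ t i) ∧ v = ∑ i, t i • (Y.get i : V)}

/-- The cone `C(Y)` is pointed: it contains no line. -/
def HasPointedCone (Y : List Γ) : Prop :=
  ∀ v ∈ cone Y, -v ∈ cone Y → v = 0

/-! Topes. -/

/-- The complement in the subspace `W` of the union of all hyperplanes of `W` generated by
subsets of `Y`. -/
def regularPoints (W : Submodule ℝ V) (Y : List Γ) : Set V :=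
  {v | v ∈ W ∧ ∀ K : Submodule ℝ V, K ≤ W → IsRational Y K →
    Module.finrank ℝ K + 1 = Module.finrank ℝ W → v ∉ K}

/-- A tope of the list `Y` in the subspace `W` that it spans: a connected component of the
complement in `W` of the union of the hyperplanes of `W` generated by subsets of `Y`. -/
def IsTope (W : Submodule ℝ V) (Y : List Γ) (τ : Set V) : Prop :=
  ∃ x ∈ regularPoints W Y, τ = connectedComponentIn (regularPoints W Y) x

/-- `τ₁` and `τ₂` are adjacent along `H`: the intersection of their closures spans `H`, which is
a hyperplane. -/
def AdjacentAlong (τ₁ τ₂ : Set V) (H : Submodule ℝ V) : Prop :=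
  Submodule.span ℝ (closure τ₁ ∩ closure τ₂) = H ∧
    Module.finrank ℝ H + 1 = Module.finrank ℝ V

/-! Functions on the lattice. -/

/-- The difference operator `(∇_a f)(b) = f(b) - f(b - a)`. -/
def nabla (a : Γ) (f : Γ → ℤ) : Γ → ℤ := fun b => f b - f (b - a)

/-- The operator `∇_Y`, the product of the (commuting) operators `∇_a` for `a` in the list `Y`. -/
def nablaList (Y : List Γ) (f : Γ → ℤ) : Γ → ℤ := Y.foldr nabla f

/-- `f` is supported on `Γ ∩ W`. -/
def SupportedOn (W : Submodule ℝ V) (f : Γ → ℤ) : Prop :=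
  ∀ γ : Γ, (γ : V) ∉ W → f γ = 0

/-- The space `F(X)`: functions `f` such that `∇_{X ∖ r} f` is supported on `r` for every rational
subspace `r`. -/
def spaceF (X : List Γ) : Set (Γ → ℤ) :=
  {f | ∀ r : Submodule ℝ V, IsRational X r → SupportedOn r (nablaList (outside X r) f)}

/-- `γ ↦ f γ * g (γ' - γ)` has finite support for every `γ'`: the convolution `f * g` makes
sense. -/
def ConvDefined (f g : Γ → ℤ) : Prop :=
  ∀ γ : Γ, {μ : Γ | f μ * g (γ - μ) ≠ 0}.Finite

/-- The convolution `(f * g)(γ) = ∑_{μ + ν = γ} f(μ) g(ν)`, meaningful when `ConvDefined f g`. -/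
def conv (f g : Γ → ℤ) : Γ → ℤ := fun γ => ∑ᶠ μ : Γ, f μ * g (γ - μ)

/-- The partition function: the number of ways to write `γ = ∑ kᵢ aᵢ` with natural numbers `kᵢ`. -/
def partitionFn (Y : List Γ) : Γ → ℤ := fun γ =>
  (Set.ncard {k : Fin Y.length → ℕ | ∑ i, k i • Y.get i = γ} : ℤ)

/-! Regular faces and the special functions attached to them. -/

/-- `F` is an open face, in the space `r^⊥` of linear forms vanishing on `r`, of the arrangement
of hyperplanes cut out by the vectors of `X ∖ r`: the set of all forms in `r^⊥` having the same
(nonzero) signs on `X ∖ r` as some given regular form `u`. -/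
def IsRegularFace (X : List Γ) (r : Submodule ℝ V) (F : Set (Module.Dual ℝ V)) : Prop :=
  ∃ u ∈ r.dualAnnihilator, (∀ a ∈ outside X r, u (a : V) ≠ 0) ∧
    F = {v | v ∈ r.dualAnnihilator ∧ ∀ a ∈ outside X r, 0 < u (a : V) * v (a : V)}

/-- The vector `a` takes positive values on the face `F`. -/
def PosOn (F : Set (Module.Dual ℝ V)) (a : Γ) : Prop := ∀ u ∈ F, 0 < u (a : V)

open Classical in
/-- The coefficients `P_Y^F` of the series
`(-1)^|B| e^{-∑_{b ∈ B} b} ∏_{a ∈ A} (∑_{k ≥ 0} e^{k a}) ∏_{b ∈ B} (∑_{k ≥ 0} e^{-k b})`,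
where `A` is the part of the list `Y` that is positive on the face `F` and `B` is the rest,
which is negative on `F` when `F` is a regular face. -/
def specialFn (F : Set (Module.Dual ℝ V)) (Y : List Γ) : Γ → ℤ := fun γ =>
  (-1) ^ (Y.filter (fun b => ¬ PosOn F b)).length *
    (Set.ncard {k : Fin Y.length → ℕ |
      ∑ i, (if PosOn F (Y.get i) then (k i : ℤ) else -((k i : ℤ) + 1)) • Y.get i = γ} : ℤ)

/-! Quasi-polynomials and the functions `f^τ`. -/

variable (Γ) in
/-- The group `Γ ∩ W`, as a subgroup of `Γ`. -/
def latticeIn (W : Submodule ℝ V) : AddSubgroup Γ :=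
  W.toAddSubgroup.comap Γ.subtype.toAddMonoidHom

/-- `q` is a quasi-polynomial on `Γ ∩ W`: it agrees with a polynomial (in the linear forms on `V`,
with real coefficients) on each coset of some subgroup of finite index of `Γ ∩ W`. -/
def IsQuasiPolynomialOn (W : Submodule ℝ V) (q : Γ → ℤ) : Prop :=
  ∃ N : AddSubgroup Γ, N ≤ latticeIn Γ W ∧ N.relIndex (latticeIn Γ W) ≠ 0 ∧
    ∀ c ∈ latticeIn Γ W, ∃ p : MvPolynomial (Module.Dual ℝ V) ℝ,
      ∀ γ ∈ latticeIn Γ W, γ - c ∈ N →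
        (q γ : ℝ) = MvPolynomial.eval (fun φ : Module.Dual ℝ V => φ (γ : V)) p

/-- `q` is a quasi-polynomial on `Γ ∩ W`, extended by zero to `Γ`, that agrees with `g`
on `τ - B(Y)`. Here `Y` is a list spanning `W` and `τ` a tope of `Y` in `W`. -/
def IsLocalPart (W : Submodule ℝ V) (Y : List Γ) (τ : Set V) (g q : Γ → ℤ) : Prop :=
  SupportedOn W q ∧ IsQuasiPolynomialOn W q ∧
    ∀ γ : Γ, (γ : V) ∈ τ - zonotope Y → q γ = g γ

/-- The function `g^τ`: the quasi-polynomial on `Γ ∩ W` (extended by zero) agreeing with `g` on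
`τ - B(Y)`. It is meaningful when there is exactly one such quasi-polynomial. -/
def localPart (W : Submodule ℝ V) (Y : List Γ) (τ : Set V) (g : Γ → ℤ) : Γ → ℤ :=
  Classical.epsilon (IsLocalPart W Y τ g)

end

end WallCrossing

open WallCrossing

/-!
The wall crossing formula rests on three facts.

*Dahmen–Micchelli functions are quasi-polynomials* (`spaceDM_isQuasiPolynomialOn`). If
`∇_{Y ∖ r} f = 0` for all proper rational `r`, then for each `a ∈ Y` the function `∇_a f` has the
same property for the list without `a`, or is zero. By induction iterated differences of `f` along a
subgroup of finite index vanish, and Newton's formula turns this into polynomiality on cosets. Two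
quasi-polynomials that agree far out on a ray agree at its origin
(`IsQuasiPolynomialOn.eq_of_eventually_eq`), which gives the uniqueness of `f^τ`.

*Localization* (`exists_mem_spaceDM_eqOn`). A function `f ∈ F(Y)` agrees on `τ - B(Y)` with a
Dahmen–Micchelli function. On functions supported in a half-space `{c ≤ u}` the operators `∇_a`
with `u(a) ≠ 0` are invertible. Taking the proper rational subspaces `r` with `∇_{Y ∖ r} f ≠ 0`
from the smallest upwards, one subtracts from `f` the solution `p` of `∇_{Y ∖ r} p = ∇_{Y ∖ r} f`
supported in a half-space of some `u` vanishing on `r`. The support of `p` plus the zonotope `B(Y)`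
lies in a cone generated by vectors `± a`, `a ∈ Y`, on which `u ≥ 0`. A tope that contains a point
with `u < 0` is disjoint from this cone (`IsTope.notMem_signedCone`), so `p` vanishes on
`τ - B(Y)`.

*Propagation across the wall* (`localPart_sub_localPart`). With `g = (∇_{X ∖ H} f)^{τ₁₂}`, the
function `h = f - f^{τ₂} - P^F * g` vanishes on `τ₂`, and `∇_{X ∖ H} h = ∇_{X ∖ H} f - g` is
supported on `H` and vanishes on `τ₁₂`. Far out along a lattice vector `v ∈ H` interior to the
common face, `h` therefore vanishes on both sides of the wall. On the side of `τ₁`, where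
`P^{-F} * g = 0`, this says that `f^{τ₁} - f^{τ₂}` and `P^F * g - P^{-F} * g` agree far out on the
rays in direction `v`; both are Dahmen–Micchelli functions, so they are equal.
-/

set_option linter.unusedSectionVars false

namespace WallCrossing

variable {V : Type*} [NormedAddCommGroup V] [NormedSpace ℝ V] {Γ : Submodule ℤ V}

/-! ### Difference operators -/

theorem nabla_comm (a b : Γ) (f : Γ → ℤ) : nabla a (nabla b f) = nabla b (nabla a f) := by
  funext γ
  simp only [nabla, sub_right_comm γ a b]
  ring

theorem nabla_sub (a : Γ) (f g : Γ → ℤ) : nabla a (f - g) = nabla a f - nabla a g := by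
  funext γ
  simp only [nabla, Pi.sub_apply]
  ring

theorem nabla_zero (a : Γ) : nabla a (0 : Γ → ℤ) = 0 := by
  funext γ
  simp [nabla]

theorem nablaList_nil (f : Γ → ℤ) : nablaList [] f = f := rfl

theorem nablaList_cons (a : Γ) (Y : List Γ) (f : Γ → ℤ) :
    nablaList (a :: Y) f = nabla a (nablaList Y f) := rfl

theorem nablaList_append (Y Z : List Γ) (f : Γ → ℤ) :
    nablaList (Y ++ Z) f = nablaList Y (nablaList Z f) :=
  List.foldr_append

theorem nablaList_perm {Y Z : List Γ} (h : Y.Perm Z) (f : Γ → ℤ) :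
    nablaList Y f = nablaList Z f := by
  have : LeftCommutative (nabla : Γ → (Γ → ℤ) → Γ → ℤ) := ⟨nabla_comm⟩
  exact h.foldr_eq f

theorem nablaList_comm (Y Z : List Γ) (f : Γ → ℤ) :
    nablaList Y (nablaList Z f) = nablaList Z (nablaList Y f) := by
  rw [← nablaList_append, ← nablaList_append]
  exact nablaList_perm List.perm_append_comm f

theorem nablaList_zero (Y : List Γ) : nablaList Y (0 : Γ → ℤ) = 0 := by
  induction Y with
  | nil => rfl
  | cons a Y ih => rw [nablaList_cons, ih, nabla_zero]

theorem nablaList_sub (Y : List Γ) (f g : Γ → ℤ) :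
    nablaList Y (f - g) = nablaList Y f - nablaList Y g := by
  induction Y with
  | nil => rfl
  | cons a Y ih => rw [nablaList_cons, ih, nabla_sub]; rfl

/-! ### Sublists inside and outside a subspace -/

theorem mem_inside {Y : List Γ} {W : Submodule ℝ V} {a : Γ} :
    a ∈ inside Y W ↔ a ∈ Y ∧ (a : V) ∈ W := by
  simp [inside]

theorem mem_outside {Y : List Γ} {W : Submodule ℝ V} {a : Γ} :
    a ∈ outside Y W ↔ a ∈ Y ∧ (a : V) ∉ W := by
  simp [outside]

theorem outside_cons_of_mem {Y : List Γ} {W : Submodule ℝ V} {a : Γ} (h : (a : V) ∈ W) :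
    outside (a :: Y) W = outside Y W := by
  simp [outside, h]

theorem outside_cons_of_notMem {Y : List Γ} {W : Submodule ℝ V} {a : Γ} (h : (a : V) ∉ W) :
    outside (a :: Y) W = a :: outside Y W := by
  simp [outside, h]

theorem outside_perm {Y Z : List Γ} (h : Y.Perm Z) (W : Submodule ℝ V) :
    (outside Y W).Perm (outside Z W) := by
  classical
  exact h.filter _

theorem outside_append_inside_perm (Y : List Γ) (W : Submodule ℝ V) :
    (outside Y W ++ inside Y W).Perm Y := by
  classical
  have h := List.filter_append_perm (fun a : Γ => decide ((a : V) ∉ W)) Y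
  have e : inside Y W = Y.filter (fun a : Γ => !decide ((a : V) ∉ W)) := by
    simp [inside]
  rw [e]
  exact h

theorem nablaList_outside_inside (Y : List Γ) (W : Submodule ℝ V) (f : Γ → ℤ) :
    nablaList (outside Y W) (nablaList (inside Y W) f) = nablaList Y f := by
  rw [← nablaList_append]
  exact nablaList_perm (outside_append_inside_perm Y W) f

theorem outside_outside_of_le (Y : List Γ) {r t : Submodule ℝ V} (h : r ≤ t) :
    outside (outside Y r) t = outside Y t := by
  simp only [outside, List.filter_filter]
  congr 1
  funext a
  by_cases ha : (a : V) ∈ t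
  · simp [ha]
  · simpa [ha] using fun h' => ha (h h')

theorem inside_outside_comm (Y : List Γ) (r t : Submodule ℝ V) :
    inside (outside Y r) t = outside (inside Y t) r := by
  simp only [outside, inside, List.filter_filter]
  congr 1
  funext a
  exact Bool.and_comm _ _

/-- If `r ≤ t`, then `∇_{Y ∖ r} = ∇_{(Y ∩ t) ∖ r} ∇_{Y ∖ t}`. -/
theorem nablaList_outside_of_le (Y : List Γ) {r t : Submodule ℝ V} (h : r ≤ t) (f : Γ → ℤ) :
    nablaList (outside (inside Y t) r) (nablaList (outside Y t) f) =
      nablaList (outside Y r) f := by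
  rw [nablaList_comm, ← nablaList_outside_inside (outside Y r) t, inside_outside_comm,
    outside_outside_of_le Y h]

/-! ### Supports and restrictions -/

theorem SupportedOn.nabla {W : Submodule ℝ V} {f : Γ → ℤ} (hf : SupportedOn W f) {a : Γ}
    (ha : (a : V) ∈ W) : SupportedOn W (nabla a f) := by
  intro γ hγ
  have h2 : ((γ - a : Γ) : V) ∉ W := fun h => hγ (by simpa using W.add_mem h ha)
  simp [WallCrossing.nabla, hf γ hγ, hf _ h2]

theorem SupportedOn.sub {W : Submodule ℝ V} {f g : Γ → ℤ} (hf : SupportedOn W f)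
    (hg : SupportedOn W g) : SupportedOn W (f - g) := by
  intro γ hγ
  simp [hf γ hγ, hg γ hγ]

theorem SupportedOn.mono {W W' : Submodule ℝ V} {f : Γ → ℤ} (hf : SupportedOn W f)
    (h : W ≤ W') : SupportedOn W' f :=
  fun γ hγ => hf γ fun h' => hγ (h h')

theorem supportedOn_zero (W : Submodule ℝ V) : SupportedOn W (0 : Γ → ℤ) := fun _ _ => rfl

open Classical in
/-- The restriction of `f` to the complement of `W`, extended by zero. -/
noncomputable def offSubspace (W : Submodule ℝ V) (f : Γ → ℤ) : Γ → ℤ :=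
  fun γ => if (γ : V) ∈ W then 0 else f γ

theorem nabla_offSubspace {W : Submodule ℝ V} {a : Γ} (ha : (a : V) ∈ W) (f : Γ → ℤ) :
    nabla a (offSubspace W f) = offSubspace W (nabla a f) := by
  funext γ
  have h2 : ((γ - a : Γ) : V) ∈ W ↔ (γ : V) ∈ W := by
    constructor
    · intro h
      simpa using W.add_mem h ha
    · intro h
      simpa using W.sub_mem h ha
  by_cases h : (γ : V) ∈ W
  · simp [nabla, offSubspace, h, h2.2 h, -AddSubgroupClass.coe_sub]
  · have h3 : ((γ : V) - (a : V)) ∉ W := fun h' => h (h2.1 (by simpa using h'))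
    simp [nabla, offSubspace, h, h3]

theorem nablaList_offSubspace {W : Submodule ℝ V} {Y : List Γ} (hY : ∀ a ∈ Y, (a : V) ∈ W)
    (f : Γ → ℤ) : nablaList Y (offSubspace W f) = offSubspace W (nablaList Y f) := by
  induction Y with
  | nil => rfl
  | cons a Y ih =>
    rw [nablaList_cons, ih fun b hb => hY b (List.mem_cons_of_mem a hb),
      nabla_offSubspace (hY a List.mem_cons_self), nablaList_cons]

theorem offSubspace_eq_zero_iff {W : Submodule ℝ V} {f : Γ → ℤ} :
    offSubspace W f = 0 ↔ SupportedOn W f := by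
  constructor
  · intro h γ hγ
    simpa [offSubspace, hγ] using congrFun h γ
  · intro h
    funext γ
    by_cases hγ : (γ : V) ∈ W
    · simp [offSubspace, hγ]
    · simp [offSubspace, hγ, h γ hγ]

/-! ### Functions supported in a half-space -/

/-- The linear form `u` is bounded below on the support of `f`. -/
def BddBelowAlong (u : Module.Dual ℝ V) (f : Γ → ℤ) : Prop :=
  ∃ c : ℝ, ∀ γ : Γ, f γ ≠ 0 → c ≤ u (γ : V)

theorem BddBelowAlong.nabla {u : Module.Dual ℝ V} {f : Γ → ℤ} (hf : BddBelowAlong u f) (a : Γ) :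
    BddBelowAlong u (nabla a f) := by
  obtain ⟨c, hc⟩ := hf
  refine ⟨min c (c + u (a : V)), fun γ hγ => ?_⟩
  by_cases h : f γ = 0
  · have h2 : f (γ - a) ≠ 0 := by
      intro h2
      simp [WallCrossing.nabla, h, h2] at hγ
    have := hc _ h2
    simp only [AddSubgroupClass.coe_sub, map_sub] at this
    exact (min_le_right _ _).trans (by linarith)
  · exact (min_le_left _ _).trans (hc γ h)

theorem BddBelowAlong.nablaList {u : Module.Dual ℝ V} {f : Γ → ℤ} (hf : BddBelowAlong u f)
    (Y : List Γ) : BddBelowAlong u (nablaList Y f) := by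
  induction Y with
  | nil => exact hf
  | cons a Y ih => exact ih.nabla a

theorem BddBelowAlong.sub {u : Module.Dual ℝ V} {f g : Γ → ℤ} (hf : BddBelowAlong u f)
    (hg : BddBelowAlong u g) : BddBelowAlong u (f - g) := by
  obtain ⟨c, hc⟩ := hf
  obtain ⟨d, hd⟩ := hg
  refine ⟨min c d, fun γ hγ => ?_⟩
  by_cases h : f γ = 0
  · have h2 : g γ ≠ 0 := by
      intro h2
      simp [h, h2] at hγ
    exact (min_le_right _ _).trans (hd γ h2)
  · exact (min_le_left _ _).trans (hc γ h)

theorem BddBelowAlong.offSubspace {u : Module.Dual ℝ V} {f : Γ → ℤ} (hf : BddBelowAlong u f)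
    (W : Submodule ℝ V) : BddBelowAlong u (offSubspace W f) := by
  obtain ⟨c, hc⟩ := hf
  refine ⟨c, fun γ hγ => hc γ fun h => hγ ?_⟩
  simp [WallCrossing.offSubspace, h]

theorem SupportedOn.bddBelowAlong {r : Submodule ℝ V} {u : Module.Dual ℝ V}
    (hu : u ∈ r.dualAnnihilator) {f : Γ → ℤ} (hf : SupportedOn r f) : BddBelowAlong u f := by
  refine ⟨0, fun γ hγ => ?_⟩
  by_contra h
  refine hγ (hf γ fun hr => h ?_)
  rw [(Submodule.mem_dualAnnihilator u).1 hu _ hr]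

theorem BddBelowAlong.eq_zero_of_nabla_eq_zero {u : Module.Dual ℝ V} {f : Γ → ℤ}
    (hf : BddBelowAlong u f) {a : Γ} (ha : u (a : V) ≠ 0) (h : WallCrossing.nabla a f = 0) :
    f = 0 := by
  obtain ⟨c, hc⟩ := hf
  have hper : ∀ γ : Γ, f (γ - a) = f γ := fun γ => by
    have := congrFun h γ
    simp only [WallCrossing.nabla, Pi.zero_apply] at this
    omega
  have hnat : ∀ (n : ℕ) (γ : Γ), f (γ - n • a) = f γ := by
    intro n
    induction n with
    | zero => simp
    | succ n ih =>
      intro γ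
      rw [succ_nsmul, ← sub_sub, hper, ih]
  have hnat' : ∀ (n : ℕ) (γ : Γ), f (γ + n • a) = f γ := fun n γ => by
    rw [← hnat n (γ + n • a), add_sub_cancel_right]
  funext γ
  by_contra hγ
  rcases lt_or_gt_of_ne ha with hneg | hpos
  · obtain ⟨n, hn⟩ := exists_nat_gt ((u (γ : V) - c) / (-u (a : V)))
    have h1 := hc (γ + n • a) (by rw [hnat']; exact hγ)
    rw [div_lt_iff₀ (by linarith)] at hn
    simp at h1
    linarith
  · obtain ⟨n, hn⟩ := exists_nat_gt ((u (γ : V) - c) / (u (a : V)))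
    have h1 := hc (γ - n • a) (by rw [hnat]; exact hγ)
    rw [div_lt_iff₀ hpos] at hn
    simp at h1
    linarith

/-- On functions supported in a half-space `{c ≤ u}`, the operators `∇_a` with `u(a) ≠ 0` are
injective. -/
theorem BddBelowAlong.eq_zero_of_nablaList_eq_zero {u : Module.Dual ℝ V} {Z : List Γ}
    (hZ : ∀ a ∈ Z, u (a : V) ≠ 0) {f : Γ → ℤ} (hf : BddBelowAlong u f)
    (h : WallCrossing.nablaList Z f = 0) : f = 0 := by
  induction Z with
  | nil => exact h
  | cons a Z ih =>
    exact ih (fun b hb => hZ b (List.mem_cons_of_mem a hb))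
      ((hf.nablaList Z).eq_zero_of_nabla_eq_zero (hZ a List.mem_cons_self) h)

theorem BddBelowAlong.eq_of_nablaList_eq {u : Module.Dual ℝ V} {Z : List Γ}
    (hZ : ∀ a ∈ Z, u (a : V) ≠ 0) {f g : Γ → ℤ} (hf : BddBelowAlong u f)
    (hg : BddBelowAlong u g) (h : WallCrossing.nablaList Z f = WallCrossing.nablaList Z g) :
    f = g := by
  refine sub_eq_zero.1 ((hf.sub hg).eq_zero_of_nablaList_eq_zero hZ ?_)
  rw [nablaList_sub, h, sub_self]

theorem exists_nabla_eq_of_pos {u : Module.Dual ℝ V} {g : Γ → ℤ} (hg : BddBelowAlong u g)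
    {a : Γ} (ha : 0 < u (a : V)) :
    ∃ p : Γ → ℤ, nabla a p = g ∧
      ∀ γ, p γ ≠ 0 → ∃ γ', g γ' ≠ 0 ∧ ∃ m : ℕ, γ = γ' + m • a := by
  obtain ⟨c, hc⟩ := hg
  have key : ∀ γ : Γ, ∃ n : ℕ, ∀ k, n ≤ k → g (γ - k • a) = 0 := by
    intro γ
    obtain ⟨n, hn⟩ := exists_nat_gt ((u (γ : V) - c) / (u (a : V)))
    refine ⟨n, fun k hk => ?_⟩
    by_contra h
    have h1 := hc _ h
    rw [div_lt_iff₀ ha] at hn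
    simp at h1
    have : (n : ℝ) * u (a : V) ≤ k * u (a : V) := by gcongr
    linarith
  have hsum : ∀ (γ : Γ) (n : ℕ), (∀ k, n ≤ k → g (γ - k • a) = 0) →
      ∑ᶠ k : ℕ, g (γ - k • a) = ∑ k ∈ Finset.range n, g (γ - k • a) := by
    intro γ n hn
    refine finsum_eq_sum_of_support_subset _ fun k hk => ?_
    by_contra h
    exact hk (hn k (by simpa using h))
  refine ⟨fun γ => ∑ᶠ k : ℕ, g (γ - k • a), ?_, ?_⟩
  · funext γ
    obtain ⟨n, hn⟩ := key γ
    have hshift : ∀ k : ℕ, γ - a - k • a = γ - (k + 1) • a := fun k => by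
      rw [succ_nsmul]
      abel
    simp only [nabla]
    rw [hsum γ (n + 1) fun k hk => hn k (by omega), hsum (γ - a) n fun k hk => by
      rw [hshift]
      exact hn _ (by omega), Finset.sum_range_succ']
    simp [hshift]
  · intro γ hγ
    obtain ⟨k, hk⟩ : ∃ k : ℕ, g (γ - k • a) ≠ 0 := by
      by_contra h
      push Not at h
      exact hγ (by simp [h])
    exact ⟨γ - k • a, hk, k, by simp⟩

theorem exists_nabla_eq {u : Module.Dual ℝ V} {g : Γ → ℤ} (hg : BddBelowAlong u g)
    {a : Γ} (ha : u (a : V) ≠ 0) :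
    ∃ p : Γ → ℤ, BddBelowAlong u p ∧ nabla a p = g ∧
      ∀ γ, p γ ≠ 0 → ∃ γ', g γ' ≠ 0 ∧ ∃ m : ℤ, γ = γ' + m • a ∧
        (0 < u (a : V) → 0 ≤ m) ∧ (u (a : V) < 0 → m ≤ -1) := by
  suffices h : ∃ p : Γ → ℤ, nabla a p = g ∧
      ∀ γ, p γ ≠ 0 → ∃ γ', g γ' ≠ 0 ∧ ∃ m : ℤ, γ = γ' + m • a ∧
        (0 < u (a : V) → 0 ≤ m) ∧ (u (a : V) < 0 → m ≤ -1) by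
    obtain ⟨p, hp, hs⟩ := h
    refine ⟨p, ?_, hp, hs⟩
    obtain ⟨c, hc⟩ := hg
    refine ⟨c, fun γ hγ => ?_⟩
    obtain ⟨γ', hγ', m, rfl, hpos, hneg⟩ := hs γ hγ
    have h1 := hc γ' hγ'
    have h2 : 0 ≤ (m : ℝ) * u (a : V) := by
      rcases lt_or_gt_of_ne ha with h | h
      · have : (m : ℝ) ≤ -1 := by exact_mod_cast hneg h
        nlinarith
      · have : (0 : ℝ) ≤ m := by exact_mod_cast hpos h
        positivity
    simp
    linarith
  rcases lt_or_gt_of_ne ha with h | h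
  · -- for `u(a) < 0` one sums in the opposite direction: `p(γ) = -∑_{k ≥ 1} g(γ + k a)`
    obtain ⟨p, hp, hs⟩ := exists_nabla_eq_of_pos (a := -a) hg (by simpa using h)
    refine ⟨fun γ => -p (γ + a), ?_, fun γ hγ => ?_⟩
    · rw [← hp]
      funext γ
      simp only [nabla, sub_neg_eq_add, sub_add_cancel]
      ring
    · obtain ⟨γ', hγ', m, hm⟩ := hs (γ + a) (by simpa using hγ)
      refine ⟨γ', hγ', -(m : ℤ) - 1, ?_, fun h' => absurd h' h.not_gt, fun _ => by omega⟩
      rw [eq_sub_of_add_eq hm, sub_zsmul, neg_zsmul, natCast_zsmul, one_zsmul, smul_neg]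
      abel
  · obtain ⟨p, hp, hs⟩ := exists_nabla_eq_of_pos hg h
    refine ⟨p, hp, fun γ hγ => ?_⟩
    obtain ⟨γ', hγ', m, hm⟩ := hs γ hγ
    exact ⟨γ', hγ', m, by simpa using hm, fun _ => by omega, fun h' => absurd h' h.not_gt⟩

/-- The convex cone of combinations `∑ cₐ a` of elements of `Y` in which every `cₐ` has (weakly)
the sign of `u(a)`; there is no condition on `cₐ` when `u(a) = 0`. -/
def signedCone (u : Module.Dual ℝ V) (Y : List Γ) : AddSubmonoid V :=
  AddSubmonoid.closure {v | ∃ a ∈ Y, ∃ c : ℝ, 0 ≤ c * u (a : V) ∧ v = c • (a : V)}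

theorem smul_mem_signedCone {u : Module.Dual ℝ V} {Y : List Γ} {a : Γ} (ha : a ∈ Y) {c : ℝ}
    (hc : 0 ≤ c * u (a : V)) : c • (a : V) ∈ signedCone u Y :=
  AddSubmonoid.subset_closure ⟨a, ha, c, hc, rfl⟩

theorem mem_zonotope_cons {a : Γ} {Y : List Γ} {z : V} :
    z ∈ zonotope (a :: Y) ↔
      ∃ t : ℝ, 0 ≤ t ∧ t ≤ 1 ∧ ∃ z' ∈ zonotope Y, z = t • (a : V) + z' := by
  constructor
  · rintro ⟨t, ht, rfl⟩
    exact ⟨t ⟨0, by simp⟩, (ht _).1, (ht _).2, _, ⟨fun i => t i.succ, fun i => ht _, rfl⟩,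
      Fin.sum_univ_succ (n := Y.length) _⟩
  · rintro ⟨t, h0, h1, _, ⟨s, hs, rfl⟩, rfl⟩
    refine ⟨Fin.cons (α := fun _ => ℝ) t s, fun i => ?_, ?_⟩
    · refine Fin.cases (by simp [h0, h1]) (fun j => ?_) i
      simpa using hs j
    · exact (Fin.sum_univ_succ (n := Y.length) (fun i => (Fin.cons (α := fun _ => ℝ) t s :
        Fin (Y.length + 1) → ℝ) i • ((a :: Y).get i : V))).symm

theorem zero_mem_zonotope (Y : List Γ) : (0 : V) ∈ zonotope Y :=
  ⟨fun _ => 0, fun _ => ⟨le_rfl, zero_le_one⟩, by simp⟩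

/-- On functions supported in a half-space `{c ≤ u}`, the operator `∇_Z` is surjective as soon as
`u` does not vanish on `Z`; the solution `p` of `∇_Z p = g` is supported on `supp g` plus a cone,
and this remains true after adding the zonotope of `Z`. -/
theorem exists_nablaList_eq {u : Module.Dual ℝ V} {Z Y : List Γ} (hZY : ∀ a ∈ Z, a ∈ Y)
    (hZ : ∀ a ∈ Z, u (a : V) ≠ 0) {g : Γ → ℤ} (hg : BddBelowAlong u g) :
    ∃ p : Γ → ℤ, BddBelowAlong u p ∧ nablaList Z p = g ∧
      ∀ γ : Γ, p γ ≠ 0 → ∃ γ' : Γ, g γ' ≠ 0 ∧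
        ∀ z ∈ zonotope Z, (γ : V) - γ' + z ∈ signedCone u Y := by
  induction Z generalizing g with
  | nil =>
    refine ⟨g, hg, rfl, fun γ hγ => ⟨γ, hγ, ?_⟩⟩
    rintro z ⟨t, -, rfl⟩
    simp
  | cons a Z ih =>
    have ha := hZ a List.mem_cons_self
    obtain ⟨q, hqb, hq, hqs⟩ := exists_nabla_eq hg ha
    obtain ⟨p, hpb, hp, hps⟩ := ih (fun b hb => hZY b (List.mem_cons_of_mem a hb))
      (fun b hb => hZ b (List.mem_cons_of_mem a hb)) hqb
    refine ⟨p, hpb, by rw [nablaList_cons, hp, hq], fun γ hγ => ?_⟩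
    obtain ⟨γ₁, hγ₁, h1⟩ := hps γ hγ
    obtain ⟨γ₂, hγ₂, m, rfl, hpos, hneg⟩ := hqs γ₁ hγ₁
    refine ⟨γ₂, hγ₂, fun z hz => ?_⟩
    obtain ⟨t, ht0, ht1, z', hz', rfl⟩ := mem_zonotope_cons.1 hz
    have hcoef : 0 ≤ ((m : ℝ) + t) * u (a : V) := by
      rcases lt_or_gt_of_ne ha with h | h
      · have : (m : ℝ) ≤ -1 := by exact_mod_cast hneg h
        nlinarith
      · have : (0 : ℝ) ≤ m := by exact_mod_cast hpos h
        positivity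
    have := add_mem (h1 z' hz') (smul_mem_signedCone (hZY a List.mem_cons_self) hcoef)
    convert this using 1
    simp only [Submodule.coe_add, add_smul, Submodule.coe_smul, Int.cast_smul_eq_zsmul]
    abel

/-! ### Lattice points of subspaces -/

theorem mem_latticeIn {W : Submodule ℝ V} {γ : Γ} : γ ∈ latticeIn Γ W ↔ (γ : V) ∈ W := Iff.rfl

/-- A spanning set of lattice vectors contains a basis. -/
theorem exists_lattice_basis [FiniteDimensional ℝ V] (S : Set Γ) :
    ∃ (d : ℕ) (b : Fin d → Γ), (∀ i, b i ∈ S) ∧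
      Submodule.span ℝ (Set.range fun i => (b i : V)) =
        Submodule.span ℝ ((fun a : Γ => (a : V)) '' S) ∧
      LinearIndependent ℝ fun i => (b i : V) := by
  obtain ⟨κ, a, -, hspan, hli⟩ := exists_linearIndependent' ℝ (fun s : S => ((s : Γ) : V))
  have : Finite κ := hli.finite
  let e := (Finite.equivFin κ).symm
  refine ⟨Nat.card κ, fun i => a (e i), fun i => (a (e i)).2, ?_, hli.comp e e.injective⟩
  have : Set.range (fun s : S => ((s : Γ) : V)) = (fun a : Γ => (a : V)) '' S := by
    ext x
    simp
  rw [← this, ← hspan, ← e.surjective.range_comp]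
  rfl

/-- A subgroup of `Γ` has finite index in `Γ ∩ W`, where `W` is its real span: every point
of `Γ ∩ W` is congruent to one of bounded norm. -/
theorem relIndex_latticeIn_ne_zero [FiniteDimensional ℝ V] [DiscreteTopology Γ]
    (N : AddSubgroup Γ) {W : Submodule ℝ V}
    (hN : Submodule.span ℝ ((fun a : Γ => (a : V)) '' (N : Set Γ)) = W) :
    N.relIndex (latticeIn Γ W) ≠ 0 := by
  obtain ⟨d, b, hb, hspan, -⟩ := exists_lattice_basis (N : Set Γ)
  set C : ℝ := ∑ i, ‖(b i : V)‖
  have hNW : ∀ γ ∈ N, (γ : V) ∈ W := fun γ hγ => by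
    rw [← hN]
    exact Submodule.subset_span ⟨γ, hγ, rfl⟩
  have hfin : {γ : Γ | ‖(γ : V)‖ ≤ C}.Finite := by
    have hd : DiscreteTopology Γ.toAddSubgroup := inferInstanceAs (DiscreteTopology Γ)
    have h1 : IsClosed (Γ.toAddSubgroup : Set V) := AddSubgroup.isClosed_of_discrete
    have h2 : IsDiscrete (Γ.toAddSubgroup : Set V) := hd.isDiscrete
    have h3 := Metric.finite_isBounded_inter_isClosed (K := Metric.closedBall (0 : V) C) h2
      Metric.isBounded_closedBall h1
    refine Set.Finite.of_finite_image (f := fun γ : Γ => (γ : V)) (h3.subset ?_)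
      Subtype.val_injective.injOn
    rintro _ ⟨γ, hγ, rfl⟩
    exact ⟨by simpa using hγ, γ.2⟩
  have hred : ∀ γ ∈ latticeIn Γ W, ∃ δ ∈ N, ‖((γ - δ : Γ) : V)‖ ≤ C := by
    intro γ hγ
    rw [mem_latticeIn, ← hN, ← hspan, Submodule.mem_span_range_iff_exists_fun] at hγ
    obtain ⟨c, hc⟩ := hγ
    refine ⟨∑ i, ⌊c i⌋ • b i, sum_mem fun i _ => zsmul_mem (hb i) _, ?_⟩
    have e : ((γ - ∑ i, ⌊c i⌋ • b i : Γ) : V) = ∑ i, Int.fract (c i) • (b i : V) := by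
      rw [AddSubgroupClass.coe_sub, ← hc]
      simp only [AddSubmonoidClass.coe_finsetSum, Submodule.coe_smul, ← Finset.sum_sub_distrib]
      refine Finset.sum_congr rfl fun i _ => ?_
      rw [← Int.self_sub_floor, sub_smul, Int.cast_smul_eq_zsmul]
    rw [e]
    refine (norm_sum_le _ _).trans (Finset.sum_le_sum fun i _ => ?_)
    rw [norm_smul, Real.norm_of_nonneg (Int.fract_nonneg _)]
    exact mul_le_of_le_one_left (norm_nonneg _) (Int.fract_lt_one _).le
  have hfin' : Finite {γ : latticeIn Γ W // ‖((γ : Γ) : V)‖ ≤ C} := by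
    have := hfin.to_subtype
    refine Finite.of_injective
      (fun γ => (⟨γ.1.1, γ.2⟩ : {γ : Γ | ‖(γ : V)‖ ≤ C})) fun x y h => ?_
    exact Subtype.ext (Subtype.ext (congrArg (fun z => z.1) h))
  have : Finite (latticeIn Γ W ⧸ N.addSubgroupOf (latticeIn Γ W)) := by
    refine Finite.of_surjective
      (fun γ : {γ : latticeIn Γ W // ‖((γ : Γ) : V)‖ ≤ C} => QuotientAddGroup.mk γ.1) fun x => ?_
    obtain ⟨γ, rfl⟩ := QuotientAddGroup.mk_surjective x
    obtain ⟨δ, hδ, hn⟩ := hred γ γ.2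
    refine ⟨⟨γ - ⟨δ, hNW δ hδ⟩, hn⟩, ?_⟩
    rw [QuotientAddGroup.eq, AddSubgroup.mem_addSubgroupOf]
    simpa using hδ
  exact AddSubgroup.index_ne_zero_of_finite

/-- Rational multiples of lattice points of `W` are dense in `W`. -/
theorem exists_latticeIn_smul_mem {W : Submodule ℝ V} {S : Set Γ}
    (hW : W = Submodule.span ℝ ((fun a : Γ => (a : V)) '' S)) {x : V} (hx : x ∈ W) {U : Set V}
    (hU : U ∈ nhds x) : ∃ n : ℕ, 0 < n ∧ ∃ v ∈ latticeIn Γ W, (n : ℝ)⁻¹ • (v : V) ∈ U := by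
  have hSW : ∀ a ∈ S, a ∈ latticeIn Γ W := fun a ha => by
    rw [mem_latticeIn, hW]
    exact Submodule.subset_span ⟨a, ha, rfl⟩
  rw [hW, Submodule.mem_span_set'] at hx
  obtain ⟨d, c, s, rfl⟩ := hx
  choose a ha has using fun i => (s i).2
  have hfl : ∀ t : ℝ, Filter.Tendsto (fun n : ℕ => (n : ℝ)⁻¹ * (⌊(n : ℝ) * t⌋ : ℝ)) Filter.atTop
      (nhds t) := by
    intro t
    have h1 : Filter.Tendsto (fun n : ℕ => t - (n : ℝ)⁻¹) Filter.atTop (nhds t) := by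
      simpa using (tendsto_const_nhds (x := t)).sub tendsto_inv_atTop_nhds_zero_nat
    refine tendsto_of_tendsto_of_tendsto_of_le_of_le' h1 tendsto_const_nhds ?_ ?_
    · filter_upwards [Filter.eventually_gt_atTop 0] with n hn
      have hn' : (0 : ℝ) < n := by exact_mod_cast hn
      have := Int.lt_floor_add_one ((n : ℝ) * t)
      rw [inv_mul_eq_div, le_div_iff₀ hn', sub_mul, inv_mul_cancel₀ hn'.ne']
      linarith
    · filter_upwards [Filter.eventually_gt_atTop 0] with n hn
      have hn' : (0 : ℝ) < n := by exact_mod_cast hn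
      rw [inv_mul_eq_div, div_le_iff₀ hn']
      linarith [Int.floor_le ((n : ℝ) * t)]
  have hlim : Filter.Tendsto
      (fun n : ℕ => (n : ℝ)⁻¹ • ((∑ i, ⌊(n : ℝ) * c i⌋ • a i : Γ) : V)) Filter.atTop
      (nhds (∑ i, c i • ((s i : V)))) := by
    have e : ∀ n : ℕ, (n : ℝ)⁻¹ • ((∑ i, ⌊(n : ℝ) * c i⌋ • a i : Γ) : V) =
        ∑ i, ((n : ℝ)⁻¹ * (⌊(n : ℝ) * c i⌋ : ℝ)) • (s i : V) := by
      intro n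
      simp only [AddSubmonoidClass.coe_finsetSum, Submodule.coe_smul, Finset.smul_sum, mul_smul,
        Int.cast_smul_eq_zsmul]
      exact Finset.sum_congr rfl fun i _ => by rw [← has i]
    simp only [e]
    exact tendsto_finsetSum _ fun i _ => (hfl (c i)).smul_const _
  obtain ⟨n, hn, hnU⟩ := ((Filter.eventually_gt_atTop 0).and (hlim hU)).exists
  exact ⟨n, hn, _, sum_mem fun i _ => zsmul_mem (hSW _ (ha i)) _, hnU⟩

/-! ### Iterated differences and quasi-polynomials -/

/-- All `k`-fold iterated differences of `f` in directions belonging to `N` vanish; that is, `f` is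
a polynomial map of degree less than `k` on each coset of `N`. -/
def IsPolyAlong (N : AddSubgroup Γ) : ℕ → (Γ → ℤ) → Prop
  | 0, f => f = 0
  | k + 1, f => ∀ a ∈ N, IsPolyAlong N k (nabla a f)

namespace IsPolyAlong

variable {N N' : AddSubgroup Γ} {k l : ℕ} {f g : Γ → ℤ}

theorem zero (N : AddSubgroup Γ) (k : ℕ) : IsPolyAlong N k (0 : Γ → ℤ) := by
  induction k with
  | zero => rfl
  | succ k ih =>
    intro a _
    rw [nabla_zero]
    exact ih

theorem sub (hf : IsPolyAlong N k f) (hg : IsPolyAlong N k g) : IsPolyAlong N k (f - g) := by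
  induction k generalizing f g with
  | zero =>
    simp only [IsPolyAlong] at hf hg ⊢
    rw [hf, hg, sub_zero]
  | succ k ih =>
    intro a ha
    rw [nabla_sub]
    exact ih (hf a ha) (hg a ha)

theorem neg (hf : IsPolyAlong N k f) : IsPolyAlong N k (-f) := by
  simpa using (zero N k).sub hf

theorem add (hf : IsPolyAlong N k f) (hg : IsPolyAlong N k g) : IsPolyAlong N k (f + g) := by
  simpa using hf.sub hg.neg

theorem shift (hf : IsPolyAlong N k f) (δ : Γ) : IsPolyAlong N k fun γ => f (γ + δ) := by
  induction k generalizing f with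
  | zero =>
    simp only [IsPolyAlong] at hf ⊢
    rw [hf]
    rfl
  | succ k ih =>
    intro a ha
    have : nabla a (fun γ => f (γ + δ)) = fun γ => nabla a f (γ + δ) := by
      funext γ
      simp only [nabla]
      rw [sub_add_eq_add_sub]
    rw [this]
    exact ih (hf a ha)

theorem nabla (hf : IsPolyAlong N k f) (a : Γ) : IsPolyAlong N k (nabla a f) := by
  have e : WallCrossing.nabla a f = f - fun γ => f (γ + -a) := by
    funext γ
    simp [WallCrossing.nabla, sub_eq_add_neg]
  rw [e]
  exact hf.sub (hf.shift _)

theorem iterate_nabla (hf : IsPolyAlong N k f) (a : Γ) (l : ℕ) :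
    IsPolyAlong N k ((WallCrossing.nabla a)^[l] f) := by
  induction l with
  | zero => exact hf
  | succ l ih =>
    rw [Function.iterate_succ_apply']
    exact ih.nabla a

theorem succ (hf : IsPolyAlong N k f) : IsPolyAlong N (k + 1) f := fun a _ => hf.nabla a

theorem mono (hf : IsPolyAlong N k f) (h : k ≤ l) : IsPolyAlong N l f := by
  induction h with
  | refl => exact hf
  | step _ ih => exact ih.succ

theorem anti (hf : IsPolyAlong N k f) (h : N' ≤ N) : IsPolyAlong N' k f := by
  induction k generalizing f with
  | zero => exact hf
  | succ k ih => exact fun a ha => ih (hf a (h ha))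

/-- The directions `a` for which `∇_a f` is polynomial along `N` form a subgroup. -/
theorem nabla_of_mem_closure {S : Set Γ}
    (h : ∀ a ∈ S, IsPolyAlong N k (WallCrossing.nabla a f)) {γ : Γ}
    (hγ : γ ∈ AddSubgroup.closure S) : IsPolyAlong N k (WallCrossing.nabla γ f) := by
  induction hγ using AddSubgroup.closure_induction with
  | mem a ha => exact h a ha
  | zero =>
    have : WallCrossing.nabla 0 f = 0 := by
      funext γ
      simp [WallCrossing.nabla]
    rw [this]
    exact zero N k
  | add a b _ _ iha ihb =>
    have : WallCrossing.nabla (a + b) f =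
        WallCrossing.nabla a f + fun γ => WallCrossing.nabla b f (γ + -a) := by
      funext γ
      simp only [WallCrossing.nabla, Pi.add_apply, ← sub_eq_add_neg, sub_sub]
      ring
    rw [this]
    exact iha.add (ihb.shift _)
  | neg a _ iha =>
    have : WallCrossing.nabla (-a) f = -fun γ => WallCrossing.nabla a f (γ + a) := by
      funext γ
      simp [WallCrossing.nabla]
    rw [this]
    exact (iha.shift _).neg

/-- Newton's backward difference formula. -/
theorem newton {b : Γ} (hb : b ∈ N) (hf : IsPolyAlong N k f) (y : Γ) (n : ℤ) :
    f (y - n • b) =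
      ∑ l ∈ Finset.range k, (-1) ^ l * Ring.choose n l * (WallCrossing.nabla b)^[l] f y := by
  induction k generalizing f n with
  | zero =>
    simp only [IsPolyAlong] at hf
    simp [hf]
  | succ k ih =>
    -- both sides have the same differences in `n` and agree at `n = 0`
    have hstep : ∀ n : ℤ, f (y - (n + 1) • b) - f (y - n • b) =
        ∑ l ∈ Finset.range (k + 1),
          (-1) ^ l * Ring.choose (n + 1) l * (WallCrossing.nabla b)^[l] f y -
        ∑ l ∈ Finset.range (k + 1),
          (-1) ^ l * Ring.choose n l * (WallCrossing.nabla b)^[l] f y := by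
      intro n
      have h1 := ih (hf b hb) n
      rw [Finset.sum_range_succ', Finset.sum_range_succ' _ k]
      simp only [Ring.choose_succ_succ, Function.iterate_succ_apply, Ring.choose_zero_right]
      have h2 : WallCrossing.nabla b f (y - n • b) = f (y - n • b) - f (y - (n + 1) • b) := by
        simp only [WallCrossing.nabla, add_smul, one_smul, sub_sub]
      rw [h2] at h1
      have h3 : ∀ (s t : ℕ → ℤ) (c : ℤ), ∑ i ∈ Finset.range k, s i + c -
          (∑ i ∈ Finset.range k, t i + c) = ∑ i ∈ Finset.range k, (s i - t i) := by
        intro s t c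
        rw [Finset.sum_sub_distrib]
        ring
      rw [h3, ← neg_sub, h1, ← Finset.sum_neg_distrib]
      exact Finset.sum_congr rfl fun i _ => by ring
    have h0 : f (y - (0 : ℤ) • b) = ∑ l ∈ Finset.range (k + 1),
        (-1) ^ l * Ring.choose (0 : ℤ) l * (WallCrossing.nabla b)^[l] f y := by
      rw [Finset.sum_range_succ']
      simp [Ring.choose_zero_succ]
    induction n using Int.induction_on with
    | zero => exact h0
    | succ n hn => linarith [hstep n]
    | pred n hn =>
      have := hstep (-n - 1)
      rw [sub_add_cancel] at this
      linarith

end IsPolyAlong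

theorem exists_isPolyAlong_common {L : AddSubgroup Γ} {ι : Type*} (s : ι → Γ → ℤ) (t : List ι)
    (h : ∀ i ∈ t, ∃ N : AddSubgroup Γ, N.relIndex L ≠ 0 ∧ ∃ k, IsPolyAlong N k (s i)) :
    ∃ N : AddSubgroup Γ, N.relIndex L ≠ 0 ∧ ∃ k, ∀ i ∈ t, IsPolyAlong N k (s i) := by
  induction t with
  | nil => exact ⟨⊤, by simp, 0, by simp⟩
  | cons i t ih =>
    obtain ⟨N, hN, k, hk⟩ := h i List.mem_cons_self
    obtain ⟨N', hN', k', hk'⟩ := ih fun j hj => h j (List.mem_cons_of_mem i hj)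
    refine ⟨N ⊓ N', AddSubgroup.relIndex_inf_ne_zero hN hN', max k k', fun j hj => ?_⟩
    rcases List.mem_cons.1 hj with rfl | hj
    · exact (hk.mono (le_max_left _ _)).anti inf_le_left
    · exact ((hk' j hj).mono (le_max_right _ _)).anti inf_le_right

variable (V) in
/-- The algebra of real polynomial functions on `V`. -/
noncomputable def polyFun : Subalgebra ℝ (V → ℝ) :=
  (MvPolynomial.aeval fun φ : Module.Dual ℝ V => (φ : V → ℝ)).range

theorem mem_polyFun {F : V → ℝ} : F ∈ polyFun V ↔
    ∃ p : MvPolynomial (Module.Dual ℝ V) ℝ, ∀ v, F v =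
      MvPolynomial.eval (fun φ : Module.Dual ℝ V => φ v) p := by
  have key : ∀ (p : MvPolynomial (Module.Dual ℝ V) ℝ) (v : V),
      MvPolynomial.aeval (fun φ : Module.Dual ℝ V => (φ : V → ℝ)) p v =
        MvPolynomial.eval (fun φ : Module.Dual ℝ V => φ v) p := by
    intro p v
    induction p using MvPolynomial.induction_on with
    | C a => simp
    | add p q hp hq => simp [hp, hq]
    | mul_X p φ hp => simp [hp]
  constructor
  · rintro ⟨p, rfl⟩
    exact ⟨p, key p⟩
  · rintro ⟨p, hp⟩
    exact ⟨p, funext fun v => (key p v).trans (hp v).symm⟩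

theorem dual_mem_polyFun (φ : Module.Dual ℝ V) : (φ : V → ℝ) ∈ polyFun V :=
  mem_polyFun.2 ⟨MvPolynomial.X φ, by simp⟩

theorem const_mem_polyFun (c : ℝ) : (fun _ : V => c) ∈ polyFun V :=
  (polyFun V).algebraMap_mem c

theorem comp_affine_mem_polyFun {F : V → ℝ} (hF : F ∈ polyFun V) (L : V →ₗ[ℝ] V) (w : V) :
    (fun v => F (L v + w)) ∈ polyFun V := by
  obtain ⟨p, hp⟩ := mem_polyFun.1 hF
  have : (fun v => F (L v + w)) =
      fun v => MvPolynomial.eval (fun φ : Module.Dual ℝ V => φ (L v + w)) p :=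
    funext fun v => hp _
  rw [this]
  clear hp this hF F
  induction p using MvPolynomial.induction_on with
  | C a => simpa using const_mem_polyFun a
  | add p q hp hq => simpa using! add_mem hp hq
  | mul_X p φ hp =>
    have h1 := add_mem (dual_mem_polyFun (φ ∘ₗ L)) (const_mem_polyFun (φ w))
    simpa [Pi.mul_def, Pi.add_def] using mul_mem hp h1

theorem polynomial_mem_polyFun (P : Polynomial ℝ) {F : V → ℝ} (hF : F ∈ polyFun V) :
    (fun v => P.eval (F v)) ∈ polyFun V := by
  have : (fun v => P.eval (F v)) = Polynomial.aeval F P := by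
    funext v
    rw [← Polynomial.coe_aeval_eq_eval]
    exact Polynomial.aeval_algHom_apply (Pi.evalAlgHom ℝ (fun _ : V => ℝ) v) F P
  rw [this]
  exact Algebra.adjoin_le (Set.singleton_subset_iff.2 hF)
    (Polynomial.aeval_mem_adjoin_singleton ℝ F)

theorem exists_polynomial_choose (l : ℕ) :
    ∃ P : Polynomial ℝ, ∀ n : ℤ, ((Ring.choose n l : ℤ) : ℝ) = P.eval (n : ℝ) := by
  refine ⟨Polynomial.C ((l.factorial : ℝ)⁻¹) * descPochhammer ℝ l, fun n => ?_⟩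
  have h := Ring.descPochhammer_eq_factorial_smul_choose n l
  have h2 : ((descPochhammer ℤ l).smeval n : ℤ) = (descPochhammer ℤ l).eval n := by
    rw [Polynomial.eval_eq_smeval]
  rw [h2] at h
  have h3 : (descPochhammer ℝ l).eval (n : ℝ) = (((descPochhammer ℤ l).eval n : ℤ) : ℝ) := by
    rw [← descPochhammer_map (Int.castRingHom ℝ) l, Polynomial.eval_intCast_map]
    simp
  rw [Polynomial.eval_mul, Polynomial.eval_C, h3, h]
  have : (l.factorial : ℝ) ≠ 0 := by positivity
  simp
  field_simp

/-- A function whose iterated differences along linearly independent lattice vectors vanish is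
polynomial on the cosets of the group generated by these vectors. -/
theorem IsPolyAlong.exists_polyFun {N : AddSubgroup Γ} {k : ℕ} {κ : Type*} (b : κ → Γ)
    (hb : ∀ i, b i ∈ N) (φ : κ → Module.Dual ℝ V) (hone : ∀ i, φ i (b i : V) = 1)
    (hzero : ∀ i j, i ≠ j → φ i (b j : V) = 0) (s : Finset κ) {f : Γ → ℤ}
    (hf : IsPolyAlong N k f) (c : Γ) :
    ∃ F ∈ polyFun V, ∀ γ : Γ, γ - c ∈ AddSubgroup.closure (b '' s) → (f γ : ℝ) = F (γ : V) := by
  classical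
  induction s using Finset.induction_on generalizing f with
  | empty =>
    refine ⟨fun _ => f c, const_mem_polyFun _, fun γ hγ => ?_⟩
    rw [Finset.coe_empty, Set.image_empty, AddSubgroup.closure_empty, AddSubgroup.mem_bot,
      sub_eq_zero] at hγ
    rw [hγ]
  | insert j s hj ih =>
    choose F hF hFf using fun l => ih (hf.iterate_nabla (b j) l)
    choose P hP using exists_polynomial_choose
    let L : V →ₗ[ℝ] V := LinearMap.id - (φ j).smulRight (b j : V)
    let w : V := φ j (c : V) • (b j : V)
    let G : V → ℝ := ∑ l ∈ Finset.range k, (fun _ => (-1 : ℝ) ^ l) *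
      (fun v => (P l).eval ((-φ j) v + φ j (c : V))) * (fun v => F l (L v + w))
    refine ⟨G, ?_, fun γ hγ => ?_⟩
    · refine sum_mem fun l _ => mul_mem (mul_mem (const_mem_polyFun _) ?_)
        (comp_affine_mem_polyFun (hF l) L w)
      exact polynomial_mem_polyFun (P l)
        (add_mem (dual_mem_polyFun (-φ j)) (const_mem_polyFun (φ j (c : V))))
    · rw [Finset.coe_insert, Set.image_insert_eq, Set.insert_eq, AddSubgroup.closure_union,
        AddSubgroup.mem_sup] at hγ
      obtain ⟨x, hx, δ, hδ, hxδ⟩ := hγ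
      obtain ⟨m, rfl⟩ := AddSubgroup.mem_closure_singleton.1 hx
      have hφδ : φ j (δ : V) = 0 := by
        clear hxδ
        induction hδ using AddSubgroup.closure_induction with
        | mem a ha =>
          obtain ⟨i, hi, rfl⟩ := ha
          exact hzero j i fun h => hj (h ▸ hi)
        | zero => simp
        | add a b _ _ h1 h2 => simp [h1, h2]
        | neg a _ h => simp [h]
      have hγ' : γ = c + m • b j + δ := by
        rw [add_assoc, hxδ]
        abel
      have hγV : (γ : V) = c + m • (b j : V) + δ := by
        rw [hγ']
        simp
      have hφγ : φ j (γ : V) = φ j (c : V) + m := by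
        rw [hγV]
        simp [hφδ, hone]
      have hnew := hf.newton (hb j) (γ - m • b j) (-m)
      rw [neg_smul, sub_neg_eq_add, sub_add_cancel] at hnew
      rw [hnew]
      simp only [G, Finset.sum_apply, Pi.mul_apply, LinearMap.neg_apply, hφγ]
      push_cast
      refine Finset.sum_congr rfl fun l _ => ?_
      have h1 : (-(φ j (c : V) + m) + φ j (c : V) : ℝ) = ((-m : ℤ) : ℝ) := by
        push_cast
        ring
      have h2 : L (γ : V) + w = ((γ - m • b j : Γ) : V) := by
        simp only [L, w, LinearMap.sub_apply, LinearMap.id_apply, LinearMap.smulRight_apply, hφγ,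
          add_smul, AddSubgroupClass.coe_sub, Submodule.coe_smul, Int.cast_smul_eq_zsmul]
        abel
      have h3 : γ - m • b j - c = δ := by
        rw [hγ']
        abel
      rw [h1, ← hP, h2, ← hFf l _ (by rw [h3]; exact hδ)]

theorem exists_dual_family {κ : Type*} {b : κ → V} (hb : LinearIndependent ℝ b) :
    ∃ φ : κ → Module.Dual ℝ V, (∀ i, φ i (b i) = 1) ∧ ∀ i j, i ≠ j → φ i (b j) = 0 := by
  have h : ∀ i, ∃ φ : Module.Dual ℝ V, φ (b i) = 1 ∧ ∀ j, i ≠ j → φ (b j) = 0 := by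
    intro i
    obtain ⟨φ, hφ⟩ := LinearMap.exists_extend ((Finsupp.lapply i).comp hb.repr)
    have key : ∀ j, φ (b j) = Finsupp.single j (1 : ℝ) i := by
      intro j
      have := congrArg (fun g => g ⟨b j, Submodule.subset_span ⟨j, rfl⟩⟩) hφ
      simp only [LinearMap.comp_apply, Submodule.subtype_apply] at this
      rw [this, hb.repr_eq_single j _ rfl]
      rfl
    exact ⟨φ, by simp [key], fun j hj => by simp [key, hj.symm]⟩
  choose φ h1 h2 using h
  exact ⟨φ, h1, h2⟩

theorem IsPolyAlong.isQuasiPolynomialOn [FiniteDimensional ℝ V] [DiscreteTopology Γ]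
    {W : Submodule ℝ V} {S : Set Γ}
    (hW : W = Submodule.span ℝ ((fun a : Γ => (a : V)) '' S)) {N : AddSubgroup Γ}
    (hN : N.relIndex (latticeIn Γ W) ≠ 0) {k : ℕ} {f : Γ → ℤ} (hf : IsPolyAlong N k f) :
    IsQuasiPolynomialOn W f := by
  obtain ⟨d, b, hbS, hbspan, hbli⟩ := exists_lattice_basis S
  have hbW : ∀ i, b i ∈ latticeIn Γ W := fun i => by
    rw [mem_latticeIn, hW]
    exact Submodule.subset_span ⟨_, hbS i, rfl⟩
  choose e he0 _ heN using fun i => AddSubgroup.exists_nsmul_mem_of_relIndex_ne_zero hN (hbW i)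
  obtain ⟨φ, hφ1, hφ0⟩ := exists_dual_family hbli
  let b' : Fin d → Γ := fun i => e i • b i
  have he0' : ∀ i, (e i : ℝ) ≠ 0 := fun i => by exact_mod_cast (he0 i).ne'
  have hb'W : ∀ i, (b' i : V) ∈ W := fun i => (heN i).2
  have hb'V : ∀ i, (b' i : V) = (e i : ℝ) • (b i : V) := fun i => by
    simp [b', Nat.cast_smul_eq_nsmul]
  have hcl : AddSubgroup.closure (Set.range b') ≤ latticeIn Γ W := by
    rw [AddSubgroup.closure_le]
    rintro _ ⟨i, rfl⟩
    exact hb'W i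
  refine ⟨AddSubgroup.closure (Set.range b'), hcl, relIndex_latticeIn_ne_zero _ ?_, fun c _ => ?_⟩
  · refine le_antisymm (Submodule.span_le.2 ?_) ?_
    · rintro _ ⟨γ, hγ, rfl⟩
      exact hcl hγ
    · rw [hW, ← hbspan, Submodule.span_le]
      rintro _ ⟨i, rfl⟩
      have : (b' i : V) ∈ Submodule.span ℝ ((fun a : Γ => (a : V)) ''
          (AddSubgroup.closure (Set.range b') : Set Γ)) :=
        Submodule.subset_span ⟨b' i, AddSubgroup.subset_closure ⟨i, rfl⟩, rfl⟩
      rw [hb'V] at this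
      simpa [he0' i] using Submodule.smul_mem _ ((e i : ℝ)⁻¹) this
  · obtain ⟨F, hF, hFf⟩ := hf.exists_polyFun b' (fun i => (heN i).1)
      (fun i => (e i : ℝ)⁻¹ • φ i) (fun i => by simp [hb'V, hφ1, he0'])
      (fun i j hij => by simp [hb'V, hφ0 i j hij]) Finset.univ c
    obtain ⟨p, hp⟩ := mem_polyFun.1 hF
    refine ⟨p, fun γ _ hγ => ?_⟩
    rw [hFf γ (by simpa using hγ), hp]

/-! ### Quasi-polynomials along rays -/

theorem IsQuasiPolynomialOn.exists_polynomial {W : Submodule ℝ V} {q : Γ → ℤ}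
    (hq : IsQuasiPolynomialOn W q) {γ v : Γ} (hγ : γ ∈ latticeIn Γ W) (hv : v ∈ latticeIn Γ W) :
    ∃ e : ℕ, 0 < e ∧ ∃ P : Polynomial ℝ,
      ∀ m : ℕ, (q (γ + (m * e) • v) : ℝ) = P.eval (m : ℝ) := by
  obtain ⟨N, -, hN, hpoly⟩ := hq
  obtain ⟨e, he, -, heN⟩ := AddSubgroup.exists_nsmul_mem_of_relIndex_ne_zero hN hv
  obtain ⟨p, hp⟩ := hpoly γ hγ
  refine ⟨e, he, MvPolynomial.aeval (fun φ : Module.Dual ℝ V =>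
    Polynomial.C (φ (γ : V)) + Polynomial.C (φ ((e • v : Γ) : V)) * Polynomial.X) p, fun m => ?_⟩
  rw [hp _ (add_mem hγ (nsmul_mem hv _)) (by
    rw [add_sub_cancel_left, mul_smul]
    exact nsmul_mem heN.1 m)]
  have hsub : ∀ A B : Module.Dual ℝ V → ℝ, MvPolynomial.eval (fun φ => A φ + B φ * m) p =
      (MvPolynomial.aeval (fun φ => Polynomial.C (A φ) + Polynomial.C (B φ) * Polynomial.X)
        p).eval (m : ℝ) := by
    intro A B
    clear hp
    induction p using MvPolynomial.induction_on with
    | C a => simp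
    | add p q hp hq => simp [hp, hq]
    | mul_X p φ hp => simp [hp]
  rw [← hsub]
  congr 2
  funext φ
  simp
  ring

/-- Two quasi-polynomials that eventually agree along the ray `γ + n v` agree at `γ`. -/
theorem IsQuasiPolynomialOn.eq_of_eventually_eq {W : Submodule ℝ V} {q q' : Γ → ℤ}
    (hq : IsQuasiPolynomialOn W q) (hq' : IsQuasiPolynomialOn W q') {γ v : Γ}
    (hγ : γ ∈ latticeIn Γ W) (hv : v ∈ latticeIn Γ W)
    (h : ∀ᶠ n : ℕ in Filter.atTop, q (γ + n • v) = q' (γ + n • v)) : q γ = q' γ := by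
  obtain ⟨e, he, P, hP⟩ := hq.exists_polynomial hγ hv
  obtain ⟨e', he', P', hP'⟩ := hq'.exists_polynomial hγ hv
  obtain ⟨n₀, hn₀⟩ := Filter.eventually_atTop.1 h
  have key : P.comp (Polynomial.C (e' : ℝ) * Polynomial.X) =
      P'.comp (Polynomial.C (e : ℝ) * Polynomial.X) := by
    refine Polynomial.eq_of_infinite_eval_eq _ _ ?_
    refine Set.Infinite.mono ?_ ((Set.Ici_infinite n₀).image
      (Nat.cast_injective (R := ℝ)).injOn)
    rintro _ ⟨m, hm, rfl⟩
    have h1 := hP (e' * m)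
    have h2 := hP' (e * m)
    have h3 : e * m * e' = e' * m * e := by ring
    have h4 : n₀ ≤ e' * m * e :=
      le_trans hm (by nlinarith [Nat.mul_pos he he', Nat.zero_le m])
    rw [h3, ← hn₀ _ h4, h1] at h2
    push_cast at h2
    simpa using h2
  have h0 := congrArg (Polynomial.eval 0) key
  have h1 := hP 0
  have h2 := hP' 0
  simp at h0 h1 h2
  exact_mod_cast h1.trans (h0.trans h2.symm)

/-! ### Rational subspaces -/

/-- The real subspace spanned by the members of the list `Y`. -/
def listSpan (Y : List Γ) : Submodule ℝ V :=
  Submodule.span ℝ {v : V | ∃ a ∈ Y, (a : V) = v}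

theorem listSpan_eq_span_image (Y : List Γ) :
    listSpan Y = Submodule.span ℝ ((fun a : Γ => (a : V)) '' {a | a ∈ Y}) := rfl

theorem mem_listSpan {Y : List Γ} {a : Γ} (ha : a ∈ Y) : (a : V) ∈ listSpan Y :=
  Submodule.subset_span ⟨a, ha, rfl⟩

theorem listSpan_le {Y : List Γ} {W : Submodule ℝ V} :
    listSpan Y ≤ W ↔ ∀ a ∈ Y, (a : V) ∈ W := by
  rw [listSpan, Submodule.span_le]
  constructor
  · intro h a ha
    exact h ⟨a, ha, rfl⟩
  · rintro h _ ⟨a, ha, rfl⟩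
    exact h a ha

theorem isRational_listSpan (Y : List Γ) : IsRational Y (listSpan Y) :=
  ⟨{a | a ∈ Y}, fun _ h => h, rfl⟩

theorem IsRational.le_listSpan {Y : List Γ} {r : Submodule ℝ V} (hr : IsRational Y r) :
    r ≤ listSpan Y := by
  obtain ⟨S, hS, rfl⟩ := hr
  exact Submodule.span_mono fun _ ⟨a, ha, h⟩ => ⟨a, hS a ha, h⟩

theorem IsRational.mono {Y Z : List Γ} (h : ∀ a ∈ Y, a ∈ Z) {r : Submodule ℝ V}
    (hr : IsRational Y r) : IsRational Z r := by
  obtain ⟨S, hS, rfl⟩ := hr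
  exact ⟨S, fun a ha => h a (hS a ha), rfl⟩

theorem IsRational.of_inside {Y : List Γ} {r t : Submodule ℝ V} (hr : IsRational (inside Y t) r) :
    IsRational Y r :=
  hr.mono fun _ h => (mem_inside.1 h).1

theorem IsRational.inside {Y : List Γ} {r t : Submodule ℝ V} (hr : IsRational Y r)
    (h : r ≤ t) : IsRational (inside Y t) r := by
  obtain ⟨S, hS, rfl⟩ := hr
  exact ⟨S, fun a ha => mem_inside.2 ⟨hS a ha, h (Submodule.subset_span ⟨a, ha, rfl⟩)⟩, rfl⟩

theorem IsRational.listSpan_inside {Y : List Γ} {r : Submodule ℝ V} (hr : IsRational Y r) :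
    listSpan (WallCrossing.inside Y r) = r :=
  le_antisymm (listSpan_le.2 fun _ h => (mem_inside.1 h).2) (hr.inside le_rfl).le_listSpan

theorem IsRational.sup_span {Y : List Γ} {r : Submodule ℝ V} (hr : IsRational Y r) {a : Γ}
    (ha : a ∈ Y) : IsRational Y (r ⊔ Submodule.span ℝ {(a : V)}) := by
  obtain ⟨S, hS, rfl⟩ := hr
  refine ⟨insert a S, ?_, ?_⟩
  · rintro b (rfl | hb)
    exacts [ha, hS b hb]
  · rw [Set.image_insert_eq, Submodule.span_insert, sup_comm]

theorem finite_isRational (Y : List Γ) : {r : Submodule ℝ V | IsRational Y r}.Finite := by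
  have h1 : {S : Set Γ | S ⊆ {a | a ∈ Y}}.Finite := (List.finite_toSet Y).finite_subsets
  refine (h1.image fun S => Submodule.span ℝ ((fun a : Γ => (a : V)) '' S)).subset ?_
  rintro r ⟨S, hS, rfl⟩
  exact ⟨S, hS, rfl⟩

/-- A rational subspace `K` is a wall of `W` if it is a hyperplane of `W`. -/
def IsWall (W : Submodule ℝ V) (Y : List Γ) (K : Submodule ℝ V) : Prop :=
  K ≤ W ∧ IsRational Y K ∧ Module.finrank ℝ K + 1 = Module.finrank ℝ W

theorem finrank_sup_span_singleton [FiniteDimensional ℝ V] {K : Submodule ℝ V} {a : V}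
    (ha : a ∉ K) : Module.finrank ℝ (K ⊔ Submodule.span ℝ {a} : Submodule ℝ V) =
      Module.finrank ℝ K + 1 := by
  have h0 : a ≠ 0 := fun h => ha (h ▸ K.zero_mem)
  have hinf : K ⊓ Submodule.span ℝ {a} = ⊥ := by
    rw [Submodule.eq_bot_iff]
    rintro x ⟨hx, hxa⟩
    obtain ⟨c, rfl⟩ := Submodule.mem_span_singleton.1 hxa
    by_contra hne
    have hc : c ≠ 0 := fun h => hne (by simp [h])
    exact ha (by simpa [hc] using K.smul_mem c⁻¹ hx)
  have h := Submodule.finrank_sup_add_finrank_inf_eq K (Submodule.span ℝ {a})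
  rw [hinf, finrank_bot, finrank_span_singleton h0] at h
  simpa using h

/-- Every proper rational subspace is contained in a wall. -/
theorem IsRational.exists_isWall [FiniteDimensional ℝ V] {Y : List Γ} {r : Submodule ℝ V}
    (hr : IsRational Y r) (hne : r ≠ listSpan Y) : ∃ K, r ≤ K ∧ IsWall (listSpan Y) Y K := by
  have hfin : {K : Submodule ℝ V | IsRational Y K ∧ K ≠ listSpan Y}.Finite :=
    (finite_isRational Y).subset fun _ h => h.1
  obtain ⟨K, hrK, hK⟩ := hfin.exists_le_maximal ⟨hr, hne⟩
  refine ⟨K, hrK, hK.prop.1.le_listSpan, hK.prop.1, ?_⟩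
  obtain ⟨a, ha, haK⟩ : ∃ a ∈ Y, (a : V) ∉ K := by
    by_contra! h
    exact hK.prop.2 (le_antisymm hK.prop.1.le_listSpan (listSpan_le.2 h))
  have hsup : K ⊔ Submodule.span ℝ {(a : V)} = listSpan Y := by
    by_contra h
    have := hK.le_of_ge ⟨hK.prop.1.sup_span ha, h⟩ le_sup_left
    exact haK (this (Submodule.mem_sup_right (Submodule.mem_span_singleton_self _)))
  rw [← hsup, finrank_sup_span_singleton haK]

theorem IsWall.exists_dual [FiniteDimensional ℝ V] {W K : Submodule ℝ V} {Y : List Γ}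
    (hK : IsWall W Y K) : ∃ φ : Module.Dual ℝ V, ∀ w ∈ W, φ w = 0 ↔ w ∈ K := by
  obtain ⟨w, hw, hwK⟩ : ∃ w ∈ W, w ∉ K := by
    by_contra! h
    have := hK.2.2
    rw [le_antisymm hK.1 h] at this
    omega
  obtain ⟨φ, hφw, hφK⟩ := Submodule.exists_dual_map_eq_bot_of_notMem hwK inferInstance
  have hφ0 : ∀ k ∈ K, φ k = 0 := fun k hk => by
    have : φ k ∈ K.map φ := ⟨k, hk, rfl⟩
    rwa [hφK] at this
  have hsup : K ⊔ Submodule.span ℝ {w} = W := by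
    refine Submodule.eq_of_le_of_finrank_eq (sup_le hK.1 ?_) ?_
    · simpa [Submodule.span_le] using hw
    · rw [finrank_sup_span_singleton hwK, hK.2.2]
  refine ⟨φ, fun x hx => ⟨fun h => ?_, hφ0 x⟩⟩
  rw [← hsup] at hx
  obtain ⟨k, hk, y, hy, rfl⟩ := Submodule.mem_sup.1 hx
  obtain ⟨c, rfl⟩ := Submodule.mem_span_singleton.1 hy
  rw [map_add, hφ0 k hk, zero_add, map_smul, smul_eq_mul] at h
  rcases mul_eq_zero.1 h with rfl | h
  · simpa using hk
  · exact absurd h hφw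

/-! ### Generalized Dahmen–Micchelli functions -/

/-- The Dahmen–Micchelli space of `Y`: the functions supported on the span of `Y` that are
annihilated by `∇_{Y ∖ r}` for every proper rational subspace `r`. -/
def spaceDM (Y : List Γ) : Set (Γ → ℤ) :=
  {f | SupportedOn (listSpan Y) f ∧
    ∀ r : Submodule ℝ V, IsRational Y r → r ≠ listSpan Y → nablaList (outside Y r) f = 0}

theorem spaceDM_sub {Y : List Γ} {f g : Γ → ℤ} (hf : f ∈ spaceDM Y) (hg : g ∈ spaceDM Y) :
    f - g ∈ spaceDM Y :=
  ⟨hf.1.sub hg.1, fun r hr h => by rw [nablaList_sub, hf.2 r hr h, hg.2 r hr h, sub_zero]⟩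

/-- Each difference `∇_a f`, with `a ∈ Y`, of a function in the Dahmen–Micchelli space of `Y` lies
in the space attached to `Y` with `a` removed, or vanishes if that list spans less. -/
theorem nabla_mem_spaceDM {a : Γ} {Y : List Γ} {f : Γ → ℤ} (hf : f ∈ spaceDM (a :: Y)) :
    nabla a f = 0 ∨ (listSpan Y = listSpan (a :: Y) ∧ nabla a f ∈ spaceDM Y) := by
  have hsub : ∀ b ∈ Y, b ∈ a :: Y := fun b hb => List.mem_cons_of_mem a hb
  by_cases hspan : listSpan Y = listSpan (a :: Y)
  · refine Or.inr ⟨hspan, ?_, fun r hr hne => ?_⟩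
    · rw [hspan]
      exact hf.1.nabla (mem_listSpan List.mem_cons_self)
    · have h := hf.2 r (hr.mono hsub) (by rwa [← hspan])
      have hcomm := nablaList_comm (outside Y r) [a] f
      simp only [nablaList_cons, nablaList_nil] at hcomm
      rw [hcomm]
      by_cases ha : (a : V) ∈ r
      · rw [outside_cons_of_mem ha] at h
        rw [h, nabla_zero]
      · rw [outside_cons_of_notMem ha] at h
        exact h
  · left
    have h := hf.2 (listSpan Y) ((isRational_listSpan Y).mono hsub) hspan
    have ha : (a : V) ∉ listSpan Y := fun ha => hspan <| le_antisymm
      (listSpan_le.2 fun b hb => mem_listSpan (hsub b hb))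
      (listSpan_le.2 fun b hb => by
        rcases List.mem_cons.1 hb with rfl | hb
        exacts [ha, mem_listSpan hb])
    have hnil : outside Y (listSpan Y) = [] :=
      List.eq_nil_iff_forall_not_mem.2 fun b hb =>
        (mem_outside.1 hb).2 (mem_listSpan (mem_outside.1 hb).1)
    rwa [outside_cons_of_notMem ha, hnil, nablaList_cons, nablaList_nil] at h

theorem listSpan_perm {Y Z : List Γ} (h : Y.Perm Z) : listSpan Y = listSpan Z :=
  le_antisymm (listSpan_le.2 fun _ ha => mem_listSpan (h.subset ha))
    (listSpan_le.2 fun _ ha => mem_listSpan (h.symm.subset ha))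

theorem spaceDM_perm {Y Z : List Γ} (h : Y.Perm Z) {f : Γ → ℤ} (hf : f ∈ spaceDM Y) :
    f ∈ spaceDM Z := by
  have hs := listSpan_perm h
  refine ⟨hs ▸ hf.1, fun r hr hne => ?_⟩
  rw [← nablaList_perm (outside_perm h r)]
  exact hf.2 r (hr.mono fun a ha => h.symm.subset ha) (hs ▸ hne)

theorem spaceDM_isPolyAlong [FiniteDimensional ℝ V] [DiscreteTopology Γ] {Y : List Γ}
    {f : Γ → ℤ} (hf : f ∈ spaceDM Y) :
    ∃ N : AddSubgroup Γ, N.relIndex (latticeIn Γ (listSpan Y)) ≠ 0 ∧ ∃ k, IsPolyAlong N k f := by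
  classical
  induction hn : Y.length using Nat.strong_induction_on generalizing Y f with
  | _ n ih =>
    have hstep : ∀ a ∈ Y, ∃ N : AddSubgroup Γ, N.relIndex (latticeIn Γ (listSpan Y)) ≠ 0 ∧
        ∃ k, IsPolyAlong N k (nabla a f) := by
      intro a ha
      have hperm := List.perm_cons_erase ha
      rcases nabla_mem_spaceDM (spaceDM_perm hperm hf) with h | ⟨hspan, h⟩
      · exact ⟨⊤, by simp, 0, h⟩
      · rw [listSpan_perm hperm, ← hspan]
        exact ih _ (by rw [← hn, hperm.length_eq]; simp) h rfl
    obtain ⟨N, hN, k, hk⟩ := exists_isPolyAlong_common (fun a => nabla a f) Y hstep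
    have hcl : (AddSubgroup.closure {a | a ∈ Y}).relIndex (latticeIn Γ (listSpan Y)) ≠ 0 := by
      refine relIndex_latticeIn_ne_zero _ (le_antisymm (Submodule.span_le.2 ?_) ?_)
      · have : AddSubgroup.closure {a | a ∈ Y} ≤ latticeIn Γ (listSpan Y) :=
          (AddSubgroup.closure_le _).2 fun a ha => mem_listSpan ha
        rintro _ ⟨γ, hγ, rfl⟩
        exact this hγ
      · exact Submodule.span_mono (Set.image_mono AddSubgroup.subset_closure)
    exact ⟨N ⊓ AddSubgroup.closure {a | a ∈ Y}, AddSubgroup.relIndex_inf_ne_zero hN hcl, k + 1,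
      fun γ hγ => (IsPolyAlong.nabla_of_mem_closure hk hγ.2).anti inf_le_left⟩

/-- Functions in the Dahmen–Micchelli space are quasi-polynomials. -/
theorem spaceDM_isQuasiPolynomialOn [FiniteDimensional ℝ V] [DiscreteTopology Γ] {Y : List Γ}
    {f : Γ → ℤ} (hf : f ∈ spaceDM Y) : IsQuasiPolynomialOn (listSpan Y) f := by
  obtain ⟨N, hN, k, hk⟩ := spaceDM_isPolyAlong hf
  exact hk.isQuasiPolynomialOn (listSpan_eq_span_image Y) hN

/-! ### Topes -/

section Tope

variable [FiniteDimensional ℝ V] {W : Submodule ℝ V} {Y : List Γ} {τ : Set V}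

theorem mem_regularPoints {x : V} :
    x ∈ regularPoints W Y ↔ x ∈ W ∧ ∀ K, IsWall W Y K → x ∉ K :=
  ⟨fun h => ⟨h.1, fun K hK => h.2 K hK.1 hK.2.1 hK.2.2⟩,
    fun h => ⟨h.1, fun K h1 h2 h3 => h.2 K ⟨h1, h2, h3⟩⟩⟩

theorem IsTope.subset_regularPoints (hτ : IsTope W Y τ) : τ ⊆ regularPoints W Y := by
  obtain ⟨x, -, rfl⟩ := hτ
  exact connectedComponentIn_subset _ _

theorem IsTope.subset (hτ : IsTope W Y τ) {x : V} (hx : x ∈ τ) : x ∈ W :=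
  (hτ.subset_regularPoints hx).1

theorem IsTope.nonempty (hτ : IsTope W Y τ) : τ.Nonempty := by
  obtain ⟨x, hx, rfl⟩ := hτ
  exact ⟨x, mem_connectedComponentIn hx⟩

theorem IsTope.eq_connectedComponentIn (hτ : IsTope W Y τ) {x : V} (hx : x ∈ τ) :
    τ = connectedComponentIn (regularPoints W Y) x := by
  obtain ⟨y, -, rfl⟩ := hτ
  exact connectedComponentIn_eq hx

/-- Each wall is cut out by a linear form that is positive on the given tope. -/
theorem IsTope.exists_dual_pos (hτ : IsTope W Y τ) {K : Submodule ℝ V} (hK : IsWall W Y K) :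
    ∃ φ : Module.Dual ℝ V, (∀ w ∈ W, φ w = 0 ↔ w ∈ K) ∧ ∀ x ∈ τ, 0 < φ x := by
  obtain ⟨x, hx⟩ := hτ.nonempty
  obtain ⟨φ, hφ, hφx⟩ : ∃ φ : Module.Dual ℝ V, (∀ w ∈ W, φ w = 0 ↔ w ∈ K) ∧ 0 < φ x := by
    obtain ⟨φ, hφ⟩ := hK.exists_dual
    have hne : φ x ≠ 0 := fun h =>
      (mem_regularPoints.1 (hτ.subset_regularPoints hx)).2 K hK ((hφ x (hτ.subset hx)).1 h)
    rcases lt_or_gt_of_ne hne with h | h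
    · exact ⟨-φ, fun w hw => by simpa using hφ w hw, by simpa using h⟩
    · exact ⟨φ, hφ, h⟩
  refine ⟨φ, hφ, fun y hy => ?_⟩
  by_contra hneg
  have hpre : IsPreconnected τ := by
    obtain ⟨z, -, rfl⟩ := hτ
    exact isPreconnected_connectedComponentIn
  obtain ⟨z, hz, hz0⟩ := hpre.intermediate_value hy hx
    (LinearMap.continuous_of_finiteDimensional φ).continuousOn ⟨not_lt.1 hneg, hφx.le⟩
  exact (mem_regularPoints.1 (hτ.subset_regularPoints hz)).2 K hK ((hφ z (hτ.subset hz)).1 hz0)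

/-- A point of `W` belongs to a tope if no wall separates it from a point of the tope. -/
theorem IsTope.mem_of_forall (hτ : IsTope W Y τ) {x y : V} (hx : x ∈ τ) (hy : y ∈ W)
    (h : ∀ K, IsWall W Y K → ∃ φ : Module.Dual ℝ V, (∀ k ∈ K, φ k = 0) ∧ 0 < φ x ∧ 0 < φ y) :
    y ∈ τ := by
  have hseg : segment ℝ x y ⊆ regularPoints W Y := by
    intro z hz
    refine mem_regularPoints.2 ⟨W.convex.segment_subset (hτ.subset hx) hy hz, fun K hK hzK => ?_⟩
    obtain ⟨φ, hφ, hφx, hφy⟩ := h K hK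
    obtain ⟨a, b, ha, hb, hab, rfl⟩ := hz
    have h0 := hφ _ hzK
    simp only [map_add, map_smul, smul_eq_mul] at h0
    rcases ha.eq_or_lt with rfl | ha
    · have : b = 1 := by linarith
      subst this
      linarith
    · have := mul_pos ha hφx
      have := mul_nonneg hb hφy.le
      linarith
  rw [hτ.eq_connectedComponentIn hx]
  exact (convex_segment x y).isPreconnected.subset_connectedComponentIn
    (left_mem_segment ℝ x y) hseg (right_mem_segment ℝ x y)

theorem finite_isWall (W : Submodule ℝ V) (Y : List Γ) : {K | IsWall W Y K}.Finite :=
  (finite_isRational Y).subset fun _ h => h.2.1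

theorem IsTope.smul_mem (hτ : IsTope W Y τ) {x : V} (hx : x ∈ τ) {t : ℝ} (ht : 0 < t) :
    t • x ∈ τ := by
  refine hτ.mem_of_forall hx (W.smul_mem t (hτ.subset hx)) fun K hK => ?_
  obtain ⟨φ, hφ, hpos⟩ := hτ.exists_dual_pos hK
  refine ⟨φ, fun k hk => (hφ k (hK.1 hk)).2 hk, hpos x hx, ?_⟩
  simpa using mul_pos ht (hpos x hx)

theorem IsTope.exists_nhds (hτ : IsTope W Y τ) {x : V} (hx : x ∈ τ) :
    ∃ U ∈ nhds x, U ∩ W ⊆ τ := by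
  choose! φ hφ hpos using fun (K : Submodule ℝ V) (hK : IsWall W Y K) => hτ.exists_dual_pos hK
  refine ⟨⋂ K ∈ {K | IsWall W Y K}, {y | 0 < φ K y},
    (Filter.biInter_mem (finite_isWall W Y)).2 fun K hK => ?_, fun y hy => ?_⟩
  · exact (isOpen_lt continuous_const (LinearMap.continuous_of_finiteDimensional (φ K))).mem_nhds
      (hpos K hK x hx)
  · refine hτ.mem_of_forall hx hy.2 fun K hK =>
      ⟨φ K, fun k hk => (hφ K hK k (hK.1 hk)).2 hk, hpos K hK x hx, ?_⟩
    exact Set.mem_iInter₂.1 hy.1 K hK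

theorem eventually_pos_add_nsmul {φ : Module.Dual ℝ V} (w : V) {v : V} (hv : 0 < φ v) :
    ∀ᶠ n : ℕ in Filter.atTop, 0 < φ (w + n • v) := by
  obtain ⟨m, hm⟩ := exists_nat_gt (-φ w / φ v)
  filter_upwards [Filter.eventually_ge_atTop m] with n hn
  rw [div_lt_iff₀ hv] at hm
  have : (m : ℝ) * φ v ≤ n * φ v := by gcongr
  simp only [map_add, map_nsmul, nsmul_eq_mul]
  linarith

theorem IsTope.eventually_add_nsmul_mem (hτ : IsTope W Y τ) {v w : V} (hv : v ∈ τ) (hw : w ∈ W) :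
    ∀ᶠ n : ℕ in Filter.atTop, w + n • v ∈ τ := by
  choose! φ hφ hpos using fun (K : Submodule ℝ V) (hK : IsWall W Y K) => hτ.exists_dual_pos hK
  have hev : ∀ᶠ n : ℕ in Filter.atTop, ∀ K ∈ {K | IsWall W Y K}, 0 < φ K (w + n • v) :=
    (Filter.eventually_all_finite (finite_isWall W Y)).2 fun K hK =>
      eventually_pos_add_nsmul w (hpos K hK v hv)
  filter_upwards [hev] with n hn
  exact hτ.mem_of_forall hv (W.add_mem hw (W.nsmul_mem (hτ.subset hv) n)) fun K hK =>
    ⟨φ K, fun k hk => (hφ K hK k (hK.1 hk)).2 hk, hpos K hK v hv, hn K hK⟩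

/-- Topes contain lattice points. -/
theorem IsTope.exists_lattice_mem {τ : Set V} (hτ : IsTope (listSpan Y) Y τ) :
    ∃ v : Γ, (v : V) ∈ τ := by
  obtain ⟨x, hx⟩ := hτ.nonempty
  obtain ⟨U, hU, hUτ⟩ := hτ.exists_nhds hx
  obtain ⟨n, hn, v, hv, hvU⟩ :=
    exists_latticeIn_smul_mem (listSpan_eq_span_image Y) (hτ.subset hx) hU
  have hn' : (0 : ℝ) < n := by exact_mod_cast hn
  refine ⟨v, ?_⟩
  have := hτ.smul_mem (hUτ ⟨hvU, Submodule.smul_mem _ _ hv⟩) hn'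
  rwa [smul_inv_smul₀ hn'.ne'] at this

/-- Regular points avoid all proper rational subspaces. -/
theorem notMem_of_mem_regularPoints {x : V} (hx : x ∈ regularPoints (listSpan Y) Y)
    {r : Submodule ℝ V} (hr : IsRational Y r) (hne : r ≠ listSpan Y) : x ∉ r := by
  obtain ⟨K, hrK, hK⟩ := hr.exists_isWall hne
  exact fun h => (mem_regularPoints.1 hx).2 K hK (hrK h)

end Tope

/-! ### A conic Carathéodory theorem -/

/-- A linear combination can be rewritten, scaling each coefficient by a nonnegative factor, so
that the vectors that are still involved are linearly independent. -/
theorem exists_linearIndepOn_support (c : Γ →₀ ℝ) :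
    ∃ c' : Γ →₀ ℝ, Finsupp.linearCombination ℝ (fun a : Γ => (a : V)) c' =
        Finsupp.linearCombination ℝ (fun a : Γ => (a : V)) c ∧
      (∀ a, ∃ l : ℝ, 0 ≤ l ∧ c' a = l * c a) ∧
      LinearIndepOn ℝ (fun a : Γ => (a : V)) (c'.support : Set Γ) := by
  induction hn : c.support.card using Nat.strong_induction_on generalizing c with
  | _ n ih =>
    by_cases hli : LinearIndepOn ℝ (fun a : Γ => (a : V)) (c.support : Set Γ)
    · exact ⟨c, rfl, fun a => ⟨1, zero_le_one, by simp⟩, hli⟩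
    · rw [linearIndepOn_iff] at hli
      push Not at hli
      obtain ⟨d, hdc, hd0, hd⟩ := hli
      have hdsub : d.support ⊆ c.support := by
        simpa using (Finsupp.mem_supported ℝ d).1 hdc
      obtain ⟨a₀, ha₀, hmin⟩ := Finset.exists_min_image d.support (fun a => |c a / d a|)
        (Finsupp.support_nonempty_iff.2 hd)
      have hda₀ := Finsupp.mem_support_iff.1 ha₀
      -- subtracting this multiple of the relation `d` kills the coefficient of `a₀`
      -- and multiplies every other one by a number in `[0, 2]`
      set t : ℝ := c a₀ / d a₀ with ht
      have hfac : ∀ a, ∃ l : ℝ, 0 ≤ l ∧ (c - t • d) a = l * c a := by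
        intro a
        by_cases hda : d a = 0
        · exact ⟨1, zero_le_one, by simp [hda]⟩
        · have hca : c a ≠ 0 :=
            Finsupp.mem_support_iff.1 (hdsub (Finsupp.mem_support_iff.2 hda))
          refine ⟨1 - t / (c a / d a), ?_, ?_⟩
          · have h1 := hmin a (Finsupp.mem_support_iff.2 hda)
            have h2 : |t / (c a / d a)| ≤ 1 := by
              rw [abs_div]
              exact div_le_one_of_le₀ h1 (abs_nonneg _)
            linarith [le_abs_self (t / (c a / d a))]
          · simp
            field_simp
      have hlt : (c - t • d).support.card < n := by
        rw [← hn]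
        refine Finset.card_lt_card ((Finset.ssubset_iff_of_subset ?_).2 ⟨a₀, hdsub ha₀, ?_⟩)
        · intro a ha
          obtain ⟨l, -, hl⟩ := hfac a
          rw [Finsupp.mem_support_iff, hl] at ha
          exact Finsupp.mem_support_iff.2 (right_ne_zero_of_mul ha)
        · simp [ht, hda₀]
      obtain ⟨c', hc', hfac', hli'⟩ := ih _ hlt (c - t • d) rfl
      refine ⟨c', ?_, fun a => ?_, hli'⟩
      · rw [hc', map_sub, map_smul, hd0, smul_zero, sub_zero]
      · obtain ⟨l, hl, h⟩ := hfac a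
        obtain ⟨l', hl', h'⟩ := hfac' a
        exact ⟨l' * l, mul_nonneg hl' hl, by rw [h', h, mul_assoc]⟩

theorem exists_finsupp_of_mem_signedCone {u : Module.Dual ℝ V} {Y : List Γ} {y : V}
    (hy : y ∈ signedCone u Y) :
    ∃ c : Γ →₀ ℝ, Finsupp.linearCombination ℝ (fun a : Γ => (a : V)) c = y ∧
      (∀ a, c a ≠ 0 → a ∈ Y) ∧ ∀ a, 0 ≤ c a * u (a : V) := by
  classical
  induction hy using AddSubmonoid.closure_induction with
  | mem y hy =>
    obtain ⟨a, ha, t, ht, rfl⟩ := hy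
    refine ⟨Finsupp.single a t, by simp, fun b hb => ?_, fun b => ?_⟩
    · by_cases h : a = b
      · exact h ▸ ha
      · simp [h] at hb
    · by_cases h : a = b
      · subst h
        simpa using ht
      · simp [h]
  | zero => exact ⟨0, by simp, by simp, by simp⟩
  | add x y _ _ hx hy =>
    obtain ⟨c, rfl, hcY, hcu⟩ := hx
    obtain ⟨d, rfl, hdY, hdu⟩ := hy
    refine ⟨c + d, by simp, fun a ha => ?_, fun a => ?_⟩
    · by_cases h : c a = 0
      · exact hdY a fun h' => ha (by simp [h, h'])
      · exact hcY a h
    · simpa [add_mul] using add_nonneg (hcu a) (hdu a)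

/-- A tope on which `u` takes a negative value does not meet the cone of combinations of `Y` with
signs prescribed by `u`: if it contained a point of the cone, it would be contained in
a simplicial cone on which `u ≥ 0`, because the facets of that simplicial cone lie in walls. -/
theorem IsTope.notMem_signedCone [FiniteDimensional ℝ V] {Y : List Γ} {τ : Set V}
    (hτ : IsTope (listSpan Y) Y τ) {u : Module.Dual ℝ V} {x y : V} (hx : x ∈ τ) (hux : u x < 0)
    (hy : y ∈ τ) : y ∉ signedCone u Y := by
  classical
  intro hyC
  obtain ⟨c₀, hc₀y, hc₀Y, hc₀u⟩ := exists_finsupp_of_mem_signedCone hyC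
  obtain ⟨c, hcy, hfac, hli⟩ := exists_linearIndepOn_support (V := V) c₀
  rw [hc₀y] at hcy
  have hcY : ∀ a ∈ c.support, a ∈ Y := fun a ha => by
    obtain ⟨l, -, hl⟩ := hfac a
    rw [Finsupp.mem_support_iff, hl] at ha
    exact hc₀Y a (right_ne_zero_of_mul ha)
  have hcu : ∀ a, 0 ≤ c a * u (a : V) := fun a => by
    obtain ⟨l, hl0, hl⟩ := hfac a
    rw [hl, mul_assoc]
    exact mul_nonneg hl0 (hc₀u a)
  have hspan : Submodule.span ℝ ((fun a : Γ => (a : V)) '' (c.support : Set Γ)) = listSpan Y := by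
    by_contra hne
    refine notMem_of_mem_regularPoints (hτ.subset_regularPoints hy)
      ⟨(c.support : Set Γ), hcY, rfl⟩ hne ?_
    rw [← hcy]
    exact (Finsupp.mem_span_image_iff_linearCombination ℝ).2
      ⟨c, (Finsupp.mem_supported ℝ c).2 le_rfl, rfl⟩
  have hxW := hτ.subset hx
  rw [← hspan, Finsupp.mem_span_image_iff_linearCombination] at hxW
  obtain ⟨e, he, hex⟩ := hxW
  have hesub : e.support ⊆ c.support := by simpa using (Finsupp.mem_supported ℝ e).1 he
  have hval : ∀ (d : Γ →₀ ℝ), d.support ⊆ c.support → ∀ φ : Module.Dual ℝ V,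
      φ (Finsupp.linearCombination ℝ (fun a : Γ => (a : V)) d) =
        ∑ a ∈ c.support, d a * φ (a : V) := by
    intro d hd φ
    rw [Finsupp.linearCombination_apply, Finsupp.sum_of_support_subset d hd _ (by simp), map_sum]
    simp
  have hsign : ∀ a ∈ c.support, 0 < e a * c a := by
    intro a ha
    obtain ⟨K, hTK, hK⟩ := IsRational.exists_isWall (Y := Y)
      (r := Submodule.span ℝ ((fun a : Γ => (a : V)) '' ((c.support : Set Γ) \ {a})))
      ⟨_, fun b hb => hcY b hb.1, rfl⟩ (fun h => by
        have h1 := (linearIndepOn_iff_notMem_span.1 hli) a ha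
        rw [h] at h1
        exact h1 (mem_listSpan (hcY a ha)))
    obtain ⟨φ, hφ, hpos⟩ := hτ.exists_dual_pos hK
    have h0 : ∀ b ∈ c.support, b ≠ a → φ (b : V) = 0 := fun b hb hba => by
      have hbK : (b : V) ∈ K := hTK (Submodule.subset_span ⟨b, ⟨hb, hba⟩, rfl⟩)
      exact (hφ _ (hK.1 hbK)).2 hbK
    have hone : ∀ d : Γ →₀ ℝ, d.support ⊆ c.support →
        φ (Finsupp.linearCombination ℝ (fun a : Γ => (a : V)) d) = d a * φ (a : V) := by
      intro d hd
      rw [hval d hd φ]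
      exact Finset.sum_eq_single_of_mem a ha fun b hb hba => by rw [h0 b hb hba, mul_zero]
    have h1 := hpos x hx
    have h2 := hpos y hy
    rw [← hex, hone e hesub] at h1
    rw [← hcy, hone c subset_rfl] at h2
    have h3 := mul_pos h1 h2
    have h4 : 0 < φ (a : V) ^ 2 := by
      have : φ (a : V) ≠ 0 := right_ne_zero_of_mul h1.ne'
      positivity
    have h5 : e a * φ (a : V) * (c a * φ (a : V)) = e a * c a * φ (a : V) ^ 2 := by ring
    rw [h5] at h3
    exact (pos_iff_pos_of_mul_pos h3).2 h4
  refine hux.not_ge ?_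
  rw [← hex, hval e hesub u]
  refine Finset.sum_nonneg fun a ha => ?_
  have h1 := hsign a ha
  have h2 : e a * u (a : V) * c a ^ 2 = e a * c a * (c a * u (a : V)) := by ring
  have h3 : 0 < c a ^ 2 := by
    have := Finsupp.mem_support_iff.1 ha
    positivity
  have h4 : 0 ≤ e a * u (a : V) * c a ^ 2 := h2 ▸ mul_nonneg h1.le (hcu a)
  exact nonneg_of_mul_nonneg_left h4 h3

/-! ### Localization of functions in `F(X)` on a tope -/

theorem exists_regular_dual [FiniteDimensional ℝ V] (Y : List Γ) {r : Submodule ℝ V} {x : V}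
    (hx : x ∉ r) : ∃ u ∈ r.dualAnnihilator, (∀ a ∈ outside Y r, u (a : V) ≠ 0) ∧ u x < 0 := by
  let S : Set V := insert x ((fun a : Γ => (a : V)) '' {a | a ∈ outside Y r})
  have hS : S.Finite := ((List.finite_toSet (outside Y r)).image _).insert x
  have : Finite S := hS
  have hSr : ∀ s : S, (s : V) ∉ r := by
    rintro ⟨s, rfl | ⟨a, ha, rfl⟩⟩
    · exact hx
    · exact (mem_outside.1 ha).2
  obtain ⟨ψ, hψ⟩ := Module.exists_dual_forall_apply_ne_zero (K := ℝ) (fun s : S => r.mkQ (s : V))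
    fun s => by simpa using hSr s
  have hne : ∀ s ∈ S, (ψ.comp r.mkQ) s ≠ 0 := fun s hs => hψ ⟨s, hs⟩
  have hr : ψ.comp r.mkQ ∈ r.dualAnnihilator := by
    rw [Submodule.mem_dualAnnihilator]
    intro w hw
    simp [(Submodule.Quotient.mk_eq_zero r).2 hw]
  have hx0 := hne x (Set.mem_insert _ _)
  rcases lt_or_gt_of_ne hx0 with h | h
  · exact ⟨_, hr, fun a ha => hne _ (Set.mem_insert_of_mem _ ⟨a, ha, rfl⟩), h⟩
  · refine ⟨-(ψ.comp r.mkQ), neg_mem hr, fun a ha => ?_, by simpa using h⟩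
    rw [LinearMap.neg_apply]
    exact neg_ne_zero.2 (hne _ (Set.mem_insert_of_mem _ ⟨a, ha, rfl⟩))

theorem IsRational.subset_signedCone {Y : List Γ} {r : Submodule ℝ V} (hr : IsRational Y r)
    {u : Module.Dual ℝ V} (hu : u ∈ r.dualAnnihilator) {w : V} (hw : w ∈ r) :
    w ∈ signedCone u Y := by
  obtain ⟨S, hS, rfl⟩ := hr
  have hu' := (Submodule.mem_dualAnnihilator u).1 hu
  rw [Submodule.mem_span_set'] at hw
  obtain ⟨n, c, s, rfl⟩ := hw
  refine sum_mem fun i _ => ?_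
  obtain ⟨a, ha, has⟩ := (s i).2
  rw [← has]
  refine smul_mem_signedCone (hS a ha) ?_
  rw [hu' _ (Submodule.subset_span ⟨a, ha, rfl⟩), mul_zero]

theorem exists_zonotope_outside (Y : List Γ) (r : Submodule ℝ V) {z : V} (hz : z ∈ zonotope Y) :
    ∃ z' ∈ zonotope (outside Y r), z - z' ∈ r := by
  induction Y generalizing z with
  | nil => exact ⟨z, hz, by simp⟩
  | cons a Y ih =>
    obtain ⟨t, ht0, ht1, z₁, hz₁, rfl⟩ := mem_zonotope_cons.1 hz
    obtain ⟨z', hz', h⟩ := ih hz₁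
    by_cases ha : (a : V) ∈ r
    · refine ⟨z', by rwa [outside_cons_of_mem ha], ?_⟩
      rw [add_sub_assoc]
      exact r.add_mem (r.smul_mem t ha) h
    · refine ⟨t • (a : V) + z', ?_, by rwa [add_sub_add_left_eq_sub]⟩
      rw [outside_cons_of_notMem ha]
      exact mem_zonotope_cons.2 ⟨t, ht0, ht1, z', hz', rfl⟩

/-- A Dahmen–Micchelli function of `Y ∩ r` is annihilated by `∇_{Y ∖ t}` for every `t` that does
not contain `r`. -/
theorem nablaList_outside_eq_zero {Y : List Γ} {r t : Submodule ℝ V} (hr : IsRational Y r)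
    {g : Γ → ℤ} (hg : g ∈ spaceDM (inside Y r)) (hrt : ¬r ≤ t) :
    nablaList (outside Y t) g = 0 := by
  -- `r ⊓ t` need not be rational: it is replaced by the span of the members of `Y` in it
  set t' := listSpan (inside Y (r ⊓ t)) with ht'
  have ht'r : t' ≤ r := listSpan_le.2 fun a ha => (mem_inside.1 ha).2.1
  have ht't : t' ≤ t := listSpan_le.2 fun a ha => (mem_inside.1 ha).2.2
  have hrat : IsRational (inside Y r) t' :=
    (isRational_listSpan _).of_inside.inside ht'r
  have heq : outside (inside Y r) t' = outside (inside Y r) t := by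
    simp only [outside]
    refine List.filter_congr fun a ha => ?_
    have : (a : V) ∈ t' ↔ (a : V) ∈ t :=
      ⟨fun h => ht't h, fun h =>
        mem_listSpan (mem_inside.2 ⟨(mem_inside.1 ha).1, (mem_inside.1 ha).2, h⟩)⟩
    simp [this]
  have h0 := hg.2 t' hrat (by
    rw [hr.listSpan_inside]
    intro h
    exact hrt (h ▸ ht't))
  rw [← nablaList_outside_inside (outside Y t) r, inside_outside_comm, ← heq, h0, nablaList_zero]

theorem mem_spaceF_supportedOn {Y : List Γ} {f : Γ → ℤ} (hf : f ∈ spaceF Y) :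
    SupportedOn (listSpan Y) f := by
  have hnil : outside Y (listSpan Y) = [] :=
    List.eq_nil_iff_forall_not_mem.2 fun b hb =>
      (mem_outside.1 hb).2 (mem_listSpan (mem_outside.1 hb).1)
  have h := hf _ (isRational_listSpan Y)
  rwa [hnil] at h

theorem spaceF_sub {Y : List Γ} {f g : Γ → ℤ} (hf : f ∈ spaceF Y) (hg : g ∈ spaceF Y) :
    f - g ∈ spaceF Y := fun r hr => by
  rw [nablaList_sub]
  exact (hf r hr).sub (hg r hr)

/-- `∇_{X ∖ H}` maps `F(X)` to `F(X ∩ H)`. -/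
theorem nablaList_outside_mem_spaceF {X : List Γ} {H : Submodule ℝ V} {f : Γ → ℤ}
    (hH : IsRational X H) (hf : f ∈ spaceF X) :
    nablaList (outside X H) f ∈ spaceF (inside X H) := by
  intro r hr
  have hrH : r ≤ H := hH.listSpan_inside ▸ hr.le_listSpan
  rw [nablaList_outside_of_le X hrH]
  exact hf r hr.of_inside

/-- A function of `F(Y)` coincides on `τ - B(Y)` with a Dahmen–Micchelli function. One removes the
proper rational subspaces `r` with `∇_{Y ∖ r} f ≠ 0` one at a time, starting with the
smallest ones, by subtracting the solution `p` of `∇_{Y ∖ r} p = ∇_{Y ∖ r} f` supported in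
a half-space chosen such that `p` vanishes on `τ - B(Y)`. -/
theorem exists_mem_spaceDM_eqOn [FiniteDimensional ℝ V] {Y : List Γ} {τ : Set V}
    (hτ : IsTope (listSpan Y) Y τ) {f : Γ → ℤ} (hf : f ∈ spaceF Y) :
    ∃ q ∈ spaceDM Y, ∀ γ : Γ, (γ : V) ∈ τ - zonotope Y → q γ = f γ := by
  let bad : (Γ → ℤ) → Set (Submodule ℝ V) := fun f =>
    {r | IsRational Y r ∧ r ≠ listSpan Y ∧ nablaList (outside Y r) f ≠ 0}
  have hfin : ∀ f, (bad f).Finite := fun f => (finite_isRational Y).subset fun _ h => h.1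
  induction hn : (bad f).ncard using Nat.strong_induction_on generalizing f with
  | _ n ih =>
    rcases (bad f).eq_empty_or_nonempty with hemp | hne
    · refine ⟨f, ⟨mem_spaceF_supportedOn hf, fun r hr h => ?_⟩, fun _ _ => rfl⟩
      by_contra h0
      have : r ∈ bad f := ⟨hr, h, h0⟩
      rw [hemp] at this
      exact this
    obtain ⟨r, hrmin⟩ := (hfin f).exists_minimal hne
    obtain ⟨hr, hrne, hr0⟩ := hrmin.prop
    set g := nablaList (outside Y r) f with hgdef
    have hgr : SupportedOn r g := hf r hr
    have hgDM : g ∈ spaceDM (inside Y r) := by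
      refine ⟨by rwa [hr.listSpan_inside], fun t ht htne => ?_⟩
      have htr : t ≤ r := hr.listSpan_inside ▸ ht.le_listSpan
      rw [hr.listSpan_inside] at htne
      rw [hgdef, nablaList_outside_of_le Y htr]
      by_contra h0
      refine htne (le_antisymm htr (hrmin.le_of_le ⟨ht.of_inside, ?_, h0⟩ htr))
      rintro rfl
      exact hrne (le_antisymm hr.le_listSpan htr)
    obtain ⟨x, hx⟩ := hτ.nonempty
    obtain ⟨u, hur, hu, hux⟩ := exists_regular_dual Y
      (notMem_of_mem_regularPoints (hτ.subset_regularPoints hx) hr hrne)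
    obtain ⟨p, hpb, hp, hps⟩ := exists_nablaList_eq (Y := Y) (fun a ha => (mem_outside.1 ha).1) hu
      (hgr.bddBelowAlong hur)
    have hp_not : ∀ t : Submodule ℝ V, ¬r ≤ t → nablaList (outside Y t) p = 0 := fun t hrt =>
      (hpb.nablaList _).eq_zero_of_nablaList_eq_zero hu (by
        rw [nablaList_comm, hp, nablaList_outside_eq_zero hr hgDM hrt])
    have hp_le : ∀ t : Submodule ℝ V, r ≤ t → SupportedOn t (nablaList (outside Y t) p) := by
      intro t hrt
      rw [← offSubspace_eq_zero_iff]
      refine ((hpb.nablaList _).offSubspace t).eq_zero_of_nablaList_eq_zero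
        (Z := outside (inside Y t) r) (fun a ha => hu a ?_) ?_
      · exact mem_outside.2 ⟨(mem_inside.1 (mem_outside.1 ha).1).1, (mem_outside.1 ha).2⟩
      · rw [nablaList_offSubspace fun a ha => (mem_inside.1 (mem_outside.1 ha).1).2,
          nablaList_outside_of_le Y hrt, hp, offSubspace_eq_zero_iff]
        exact hgr.mono hrt
    have hpF : p ∈ spaceF Y := by
      intro t _
      by_cases hrt : r ≤ t
      · exact hp_le t hrt
      · rw [hp_not t hrt]
        exact supportedOn_zero t
    have hbad : (bad (f - p)).ncard < n := by
      rw [← hn]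
      refine Set.ncard_lt_ncard ⟨?_, fun hsub => ?_⟩ (hfin f)
      · rintro t ⟨ht, htne, ht0⟩
        refine ⟨ht, htne, fun h0 => ?_⟩
        rw [nablaList_sub, h0, zero_sub, neg_ne_zero] at ht0
        by_cases hrt : r ≤ t
        · refine hr0 ?_
          rw [hgdef, ← nablaList_outside_of_le Y hrt, h0, nablaList_zero]
        · exact ht0 (hp_not t hrt)
      · refine (hsub hrmin.prop).2.2 ?_
        rw [nablaList_sub, hp, sub_self]
    obtain ⟨q, hq, hqf⟩ := ih _ hbad (spaceF_sub hf hpF) rfl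
    refine ⟨q, hq, fun γ hγ => ?_⟩
    have hp0 : p γ = 0 := by
      by_contra hpγ
      obtain ⟨γ', hγ', hcone⟩ := hps γ hpγ
      obtain ⟨y, hy, z, hz, hyz⟩ := Set.mem_sub.1 hγ
      obtain ⟨z', hz', hzr⟩ := exists_zonotope_outside Y r hz
      have hγ'r : (γ' : V) ∈ r := by
        by_contra h
        exact hγ' (hgr γ' h)
      refine hτ.notMem_signedCone hx hux hy ?_
      have e : y = ((γ : V) - γ' + z') + (γ' + (z - z')) := by
        rw [← hyz]
        abel
      rw [e]
      exact add_mem (hcone z' hz') (hr.subset_signedCone hur (r.add_mem hγ'r hzr))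
    rw [hqf γ hγ, Pi.sub_apply, hp0, sub_zero]

section LocalPart

variable [FiniteDimensional ℝ V] {Y : List Γ} {τ : Set V}

theorem IsLocalPart.eq (hτ : IsTope (listSpan Y) Y τ) {g q q' : Γ → ℤ}
    (hq : IsLocalPart (listSpan Y) Y τ g q) (hq' : IsLocalPart (listSpan Y) Y τ g q') :
    q = q' := by
  funext γ
  by_cases hγ : (γ : V) ∈ listSpan Y
  · obtain ⟨v, hv⟩ := hτ.exists_lattice_mem
    refine hq.2.1.eq_of_eventually_eq hq'.2.1 (mem_latticeIn.2 hγ)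
      (mem_latticeIn.2 (hτ.subset hv)) ?_
    filter_upwards [hτ.eventually_add_nsmul_mem hv hγ] with n hn
    have hmem : ((γ + n • v : Γ) : V) ∈ τ - zonotope Y :=
      Set.mem_sub.2 ⟨_, hn, 0, zero_mem_zonotope Y, by simp⟩
    rw [hq.2.2 _ hmem, hq'.2.2 _ hmem]
  · rw [hq.1 γ hγ, hq'.1 γ hγ]

variable [DiscreteTopology Γ]

theorem existsUnique_isLocalPart (hτ : IsTope (listSpan Y) Y τ) {f : Γ → ℤ}
    (hf : f ∈ spaceF Y) : ∃! q, IsLocalPart (listSpan Y) Y τ f q := by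
  obtain ⟨q, hq, hqf⟩ := exists_mem_spaceDM_eqOn hτ hf
  have hloc : IsLocalPart (listSpan Y) Y τ f q := ⟨hq.1, spaceDM_isQuasiPolynomialOn hq, hqf⟩
  exact ⟨q, hloc, fun q' hq' => hq'.eq hτ hloc⟩

theorem localPart_isLocalPart (hτ : IsTope (listSpan Y) Y τ) {f : Γ → ℤ}
    (hf : f ∈ spaceF Y) :
    IsLocalPart (listSpan Y) Y τ f (localPart (listSpan Y) Y τ f) :=
  Classical.epsilon_spec (existsUnique_isLocalPart hτ hf).exists

theorem localPart_mem_spaceDM (hτ : IsTope (listSpan Y) Y τ) {f : Γ → ℤ}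
    (hf : f ∈ spaceF Y) : localPart (listSpan Y) Y τ f ∈ spaceDM Y := by
  obtain ⟨q, hq, hqf⟩ := exists_mem_spaceDM_eqOn hτ hf
  have hloc : IsLocalPart (listSpan Y) Y τ f q := ⟨hq.1, spaceDM_isQuasiPolynomialOn hq, hqf⟩
  rwa [(localPart_isLocalPart hτ hf).eq hτ hloc]

theorem localPart_apply (hτ : IsTope (listSpan Y) Y τ) {f : Γ → ℤ} (hf : f ∈ spaceF Y) {γ : Γ}
    (hγ : (γ : V) ∈ τ) : localPart (listSpan Y) Y τ f γ = f γ :=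
  (localPart_isLocalPart hτ hf).2.2 γ
    (Set.mem_sub.2 ⟨_, hγ, 0, zero_mem_zonotope Y, by simp⟩)

end LocalPart

/-! ### Counting functions -/

/-- The number of ways of writing `γ = ∑ w(aᵢ, kᵢ)`, where `aᵢ` runs over the list `Y` and `kᵢ`
over the natural numbers. The partition functions and the functions `P^F` are of this type. -/
noncomputable def countFn (w : Γ → ℕ → Γ) (Y : List Γ) : Γ → ℤ := fun γ =>
  (Set.ncard {k : Fin Y.length → ℕ | ∑ i, w (Y.get i) (k i) = γ} : ℤ)

/-- The form `u` is proper for the terms `w(a, k)`, `a ∈ Y`: it grows at least linearly in `k`. -/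
def IsProperWeight (u : Module.Dual ℝ V) (w : Γ → ℕ → Γ) (Y : List Γ) : Prop :=
  ∀ a ∈ Y, ∃ d : ℝ, 0 < d ∧ ∀ k : ℕ, k * d ≤ u (w a k : V)

open Classical in
/-- The function on `Γ` equal to `1` at `0` and to `0` elsewhere. -/
noncomputable def delta : Γ → ℤ := Pi.single 0 1

section Count

variable {u : Module.Dual ℝ V} {w : Γ → ℕ → Γ} {Y : List Γ}

theorem IsProperWeight.finite_le (h : IsProperWeight u w Y) (c : ℝ) :
    {k : Fin Y.length → ℕ | u ((∑ i, w (Y.get i) (k i) : Γ) : V) ≤ c}.Finite := by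
  choose! d hd0 hd using h
  have hbox : (Set.univ.pi fun i : Fin Y.length =>
      Set.Iic ⌊c / d (Y.get i)⌋₊).Finite := Set.Finite.pi fun i => Set.finite_Iic _
  refine hbox.subset fun k hk i _ => ?_
  have hmem : ∀ i, Y.get i ∈ Y := fun i => List.get_mem Y i
  have hterm : ∀ i, (k i : ℝ) * d (Y.get i) ≤ u (w (Y.get i) (k i) : V) :=
    fun i => hd _ (hmem i) (k i)
  have hnn : ∀ i, 0 ≤ u (w (Y.get i) (k i) : V) := fun i =>
    (mul_nonneg (Nat.cast_nonneg _) (hd0 _ (hmem i)).le).trans (hterm i)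
  have hsum : u (w (Y.get i) (k i) : V) ≤ c := by
    refine le_trans ?_ hk
    rw [AddSubmonoidClass.coe_finsetSum, map_sum]
    exact Finset.single_le_sum (f := fun i => u (w (Y.get i) (k i) : V))
      (fun j _ => hnn j) (Finset.mem_univ i)
  exact Nat.le_floor ((le_div_iff₀ (hd0 _ (hmem i))).2 ((hterm i).trans hsum))

theorem IsProperWeight.finite_eq (h : IsProperWeight u w Y) (γ : Γ) :
    {k : Fin Y.length → ℕ | ∑ i, w (Y.get i) (k i) = γ}.Finite :=
  (h.finite_le (u (γ : V))).subset fun k (hk : _ = γ) => by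
    simp only [Set.mem_ofPred_eq, hk]
    exact le_rfl

theorem countFn_ne_zero {γ : Γ} (h : countFn w Y γ ≠ 0) :
    ∃ k : Fin Y.length → ℕ, ∑ i, w (Y.get i) (k i) = γ := by
  have : Set.ncard {k : Fin Y.length → ℕ | ∑ i, w (Y.get i) (k i) = γ} ≠ 0 := by
    simpa [countFn] using h
  exact Set.nonempty_of_ncard_ne_zero this

theorem IsProperWeight.nonneg_of_countFn_ne_zero (h : IsProperWeight u w Y) {γ : Γ}
    (hγ : countFn w Y γ ≠ 0) : 0 ≤ u (γ : V) := by
  obtain ⟨k, rfl⟩ := countFn_ne_zero hγ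
  rw [AddSubmonoidClass.coe_finsetSum, map_sum]
  refine Finset.sum_nonneg fun i _ => ?_
  obtain ⟨d, hd0, hd⟩ := h _ (List.get_mem Y i)
  exact (mul_nonneg (Nat.cast_nonneg _) hd0.le).trans (hd (k i))

theorem IsProperWeight.finite_countFn_ne_zero (h : IsProperWeight u w Y) (c : ℝ) :
    {γ : Γ | countFn w Y γ ≠ 0 ∧ u (γ : V) ≤ c}.Finite := by
  refine ((h.finite_le c).image fun k => ∑ i, w (Y.get i) (k i)).subset ?_
  rintro γ ⟨hγ, hc⟩
  obtain ⟨k, rfl⟩ := countFn_ne_zero hγ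
  exact ⟨k, hc, rfl⟩

theorem countFn_nil : countFn w ([] : List Γ) = delta := by
  funext γ
  by_cases h : γ = 0
  · subst h
    simp [countFn, delta]
  · have : ∀ k : Fin ([] : List Γ).length → ℕ, ¬(∑ i, w (([] : List Γ).get i) (k i) = γ) := by
      intro k hk
      exact h (by simpa using hk.symm)
    simp only [countFn, this, Set.ofPred_false, Set.ncard_empty, delta, Pi.single_apply, h,
      if_false, Nat.cast_zero]

/-- Recursion for the counting function: the first index is either zero or a successor. -/
theorem countFn_cons {a b : Γ} (h : IsProperWeight u w (a :: Y))
    (hb : ∀ k, w a (k + 1) = b + w a k) (γ : Γ) :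
    countFn w (a :: Y) γ = countFn w Y (γ - w a 0) + countFn w (a :: Y) (γ - b) := by
  have hsum : ∀ k : Fin (a :: Y).length → ℕ, ∑ i, w ((a :: Y).get i) (k i) =
      w a (k ⟨0, by simp⟩) + ∑ i : Fin Y.length, w (Y.get i) (k i.succ) :=
    fun k => Fin.sum_univ_succ (n := Y.length) _
  let z : (Fin Y.length → ℕ) → (Fin (a :: Y).length → ℕ) :=
    fun k => Fin.cons (n := Y.length) (α := fun _ => ℕ) 0 k
  let s : (Fin (a :: Y).length → ℕ) → (Fin (a :: Y).length → ℕ) :=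
    fun k => Fin.cons (n := Y.length) (α := fun _ => ℕ) (k ⟨0, by simp⟩ + 1) fun i => k i.succ
  have hz : Function.Injective z := fun k l hkl => by
    funext i
    exact congrFun hkl i.succ
  have hs : Function.Injective s := fun k l hkl => by
    funext i
    refine Fin.cases ?_ (fun j => ?_) i
    · have := congrFun hkl ⟨0, by simp⟩
      exact Nat.succ_injective this
    · exact congrFun hkl j.succ
  have hunion : {k : Fin (a :: Y).length → ℕ | ∑ i, w ((a :: Y).get i) (k i) = γ} =
      z '' {k | ∑ i, w (Y.get i) (k i) = γ - w a 0} ∪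
        s '' {k | ∑ i, w ((a :: Y).get i) (k i) = γ - b} := by
    ext k
    simp only [Set.mem_ofPred_eq, Set.mem_union, Set.mem_image]
    constructor
    · intro hk
      rw [hsum] at hk
      rcases hk0 : k ⟨0, by simp⟩ with _ | m
      · left
        refine ⟨fun i => k i.succ, ?_, ?_⟩
        · rw [← hk, hk0]
          abel
        · funext i
          refine Fin.cases ?_ (fun j => rfl) i
          exact hk0.symm
      · right
        refine ⟨Fin.cons (n := Y.length) (α := fun _ => ℕ) m fun i => k i.succ, ?_, ?_⟩
        · rw [hsum, ← hk, hk0, hb]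
          simp only [add_assoc, add_sub_cancel_left]
          rfl
        · funext i
          refine Fin.cases ?_ (fun j => rfl) i
          exact hk0.symm
    · rintro (⟨k, hk, rfl⟩ | ⟨k, hk, rfl⟩)
      · rw [hsum]
        change w a 0 + ∑ i : Fin Y.length, w (Y.get i) (k i) = γ
        rw [hk]
        abel
      · rw [hsum] at hk ⊢
        change w a (k ⟨0, by simp⟩ + 1) + ∑ i : Fin Y.length, w (Y.get i) (k i.succ) = γ
        rw [hb, add_assoc, hk]
        abel
  have hY : IsProperWeight u w Y := fun c hc => h c (List.mem_cons_of_mem a hc)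
  have hdisj : Disjoint (z '' {k | ∑ i, w (Y.get i) (k i) = γ - w a 0})
      (s '' {k | ∑ i, w ((a :: Y).get i) (k i) = γ - b}) := by
    rw [Set.disjoint_left]
    rintro _ ⟨k, -, rfl⟩ ⟨l, -, hl⟩
    exact Nat.succ_ne_zero _ (congrFun hl ⟨0, Nat.succ_pos _⟩)
  simp only [countFn]
  rw [hunion, Set.ncard_union_eq hdisj ((hY.finite_eq _).image z) ((h.finite_eq _).image s),
    Set.ncard_image_of_injective _ hz, Set.ncard_image_of_injective _ hs]
  push_cast
  rfl

end Count

theorem partitionFn_eq_countFn (Y : List Γ) : partitionFn Y = countFn (fun a k => k • a) Y := rfl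

section Partition

variable {u : Module.Dual ℝ V} {Y : List Γ}

theorem isProperWeight_partition (hY : ∀ a ∈ Y, 0 < u (a : V)) :
    IsProperWeight u (fun (a : Γ) (k : ℕ) => k • a) Y := fun a ha =>
  ⟨u (a : V), hY a ha, fun k => by simp⟩

theorem partitionFn_bddBelowAlong (hY : ∀ a ∈ Y, 0 < u (a : V)) :
    BddBelowAlong u (partitionFn Y) :=
  ⟨0, fun _ hγ => (isProperWeight_partition hY).nonneg_of_countFn_ne_zero hγ⟩

theorem nablaList_partitionFn (hY : ∀ a ∈ Y, 0 < u (a : V)) :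
    nablaList Y (partitionFn Y) = delta := by
  rw [partitionFn_eq_countFn]
  induction Y with
  | nil => exact countFn_nil (w := fun (a : Γ) (k : ℕ) => k • a)
  | cons a Y ih =>
    have hY' : ∀ b ∈ Y, 0 < u (b : V) := fun b hb => hY b (List.mem_cons_of_mem a hb)
    have hcomm := nablaList_comm Y [a] (countFn (fun a k => k • a) (a :: Y))
    simp only [nablaList_cons, nablaList_nil] at hcomm
    rw [nablaList_cons, ← hcomm, ← ih hY']
    congr 1
    funext γ
    have := countFn_cons (isProperWeight_partition hY) (b := a) (fun k => succ_nsmul' a k) γ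
    simp only [zero_smul, sub_zero] at this
    simp only [nabla]
    linarith

theorem partitionFn_supportedOn {W : Submodule ℝ V} (hY : ∀ a ∈ Y, (a : V) ∈ W) :
    SupportedOn W (partitionFn Y) := by
  intro γ hγ
  by_contra h
  obtain ⟨k, rfl⟩ := countFn_ne_zero (w := fun (a : Γ) (k : ℕ) => k • a) h
  refine hγ ?_
  rw [AddSubmonoidClass.coe_finsetSum]
  exact sum_mem fun i _ => W.nsmul_mem (hY _ (List.get_mem Y i)) _

theorem nablaList_outside_partitionFn (hY : ∀ a ∈ Y, 0 < u (a : V)) (r : Submodule ℝ V) :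
    nablaList (outside Y r) (partitionFn Y) = partitionFn (inside Y r) := by
  have hin : ∀ a ∈ inside Y r, 0 < u (a : V) := fun a ha => hY a (mem_inside.1 ha).1
  refine ((partitionFn_bddBelowAlong hY).nablaList _).eq_of_nablaList_eq
    (fun a ha => (hin a ha).ne') (partitionFn_bddBelowAlong hin) ?_
  rw [nablaList_comm, nablaList_outside_inside, nablaList_partitionFn hY,
    nablaList_partitionFn hin]

theorem partitionFn_mem_spaceF (hY : ∀ a ∈ Y, 0 < u (a : V)) : partitionFn Y ∈ spaceF Y := by
  intro r _
  rw [nablaList_outside_partitionFn hY]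
  exact partitionFn_supportedOn fun a ha => (mem_inside.1 ha).2

end Partition

/-- A linear form positive on the nonzero vectors of a list generating a pointed cone. -/
theorem HasPointedCone.exists_dual_pos [FiniteDimensional ℝ V] {Y : List Γ}
    (hY : HasPointedCone Y) (h0 : ∀ a ∈ Y, a ≠ 0) :
    ∃ u : Module.Dual ℝ V, ∀ a ∈ Y, 0 < u (a : V) := by
  let K : Set V := convexHull ℝ (Set.range fun i : Fin Y.length => (Y.get i : V))
  have hK : IsCompact K := (Set.finite_range _).isCompact_convexHull (𝕜 := ℝ)
  have h0K : (0 : V) ∉ K := by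
    intro h
    obtain ⟨c, hc0, hc1, hc⟩ : ∃ c : Fin Y.length → ℝ, (∀ i, 0 ≤ c i) ∧ ∑ i, c i = 1 ∧
        ∑ i, c i • (Y.get i : V) = 0 := by
      let L : (Fin Y.length → ℝ) →ₗ[ℝ] V :=
        Fintype.linearCombination ℝ fun i : Fin Y.length => (Y.get i : V)
      have hKL : K = L '' stdSimplex ℝ (Fin Y.length) := by
        rw [← convexHull_basis_eq_stdSimplex, LinearMap.image_convexHull, ← Set.range_comp]
        refine congrArg (fun f => convexHull ℝ (Set.range f)) (funext fun i => ?_)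
        simp [L, Fintype.linearCombination_apply]
      rw [hKL] at h
      obtain ⟨c, hc, hLc⟩ := h
      exact ⟨c, hc.1, hc.2, by rw [← hLc]; rfl⟩
    obtain ⟨j, hj⟩ : ∃ j, 0 < c j := by
      by_contra! hle
      have : ∑ i, c i ≤ 0 := Finset.sum_nonpos fun i _ => hle i
      linarith
    have h1 : c j • (Y.get j : V) ∈ cone Y :=
      ⟨Pi.single j (c j), fun i => by
        by_cases h : i = j
        · subst h
          simpa using hc0 i
        · simp [h], by simp [Pi.single_apply]⟩
    have h2 : -(c j • (Y.get j : V)) ∈ cone Y := by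
      refine ⟨Function.update c j 0, fun i => ?_, ?_⟩
      · by_cases h : i = j
        · subst h
          simp
        · simpa [h] using hc0 i
      · rw [← Finset.add_sum_erase _ _ (Finset.mem_univ j)] at hc ⊢
        rw [neg_eq_of_add_eq_zero_right hc, Function.update_self, zero_smul, zero_add]
        refine Finset.sum_congr rfl fun i hi => ?_
        rw [Function.update_of_ne (Finset.ne_of_mem_erase hi)]
    have h3 := hY _ h1 h2
    refine h0 _ (List.get_mem Y j) ?_
    have := (smul_eq_zero.1 h3).resolve_left hj.ne'
    exact_mod_cast this
  obtain ⟨φ, hφ⟩ : ∃ φ : V →L[ℝ] ℝ, ∀ x ∈ K, 0 < φ x := by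
    obtain ⟨φ, s, h1, h2⟩ := geometric_hahn_banach_point_closed (convex_convexHull ℝ _)
      hK.isClosed h0K
    exact ⟨φ, fun x hx => by
      have := h2 x hx
      simp at h1
      linarith⟩
  refine ⟨φ, fun a ha => ?_⟩
  obtain ⟨i, rfl⟩ := List.get_of_mem ha
  exact hφ _ (subset_convexHull ℝ _ ⟨i, rfl⟩)

/-! ### Convolution -/

section Conv

variable {P P' g : Γ → ℤ}

theorem conv_delta (g : Γ → ℤ) : conv delta g = g := by
  funext γ
  rw [conv, finsum_eq_single _ (0 : Γ) fun μ hμ => by simp [delta, hμ]]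
  simp [delta]

theorem conv_sub (hP : ConvDefined P g) (hP' : ConvDefined P' g) :
    conv (P - P') g = conv P g - conv P' g := by
  funext γ
  simp only [conv, Pi.sub_apply, sub_mul]
  exact finsum_sub_distrib (hP γ) (hP' γ)

theorem ConvDefined.shift (hP : ConvDefined P g) (a : Γ) :
    ConvDefined (fun μ => P (μ - a)) g := by
  intro γ
  refine ((hP (γ - a)).image fun μ => μ + a).subset fun μ hμ => ⟨μ - a, ?_, by simp⟩
  have e : γ - a - (μ - a) = γ - μ := by abel
  simpa [e] using hμ

theorem conv_shift (P g : Γ → ℤ) (a γ : Γ) :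
    conv (fun μ => P (μ - a)) g γ = conv P g (γ - a) := by
  simp only [conv]
  rw [← finsum_comp_equiv (Equiv.addRight a)]
  refine finsum_congr fun μ => ?_
  have e : γ - (μ + a) = γ - a - μ := by abel
  simp [e]

theorem ConvDefined.nabla (hP : ConvDefined P g) (a : Γ) : ConvDefined (nabla a P) g := by
  intro γ
  refine ((hP γ).union (hP.shift a γ)).subset fun μ hμ => ?_
  by_contra h
  simp only [Set.mem_union, Set.mem_ofPred_eq, not_or, not_not] at h
  refine hμ ?_
  simp only [WallCrossing.nabla, sub_mul, h.1, h.2, sub_zero]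

theorem ConvDefined.nablaList (hP : ConvDefined P g) (Z : List Γ) :
    ConvDefined (nablaList Z P) g := by
  induction Z with
  | nil => exact hP
  | cons a Z ih => exact ih.nabla a

theorem nablaList_conv (hP : ConvDefined P g) (Z : List Γ) :
    nablaList Z (conv P g) = conv (nablaList Z P) g := by
  induction Z with
  | nil => rfl
  | cons a Z ih =>
    have hd := hP.nablaList Z
    have e : nabla a (nablaList Z P) = nablaList Z P - fun μ => nablaList Z P (μ - a) := rfl
    rw [nablaList_cons, ih, nablaList_cons, e, conv_sub hd (hd.shift a)]
    funext γ
    simp only [nabla, Pi.sub_apply, conv_shift]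

theorem conv_ne_zero {γ : Γ} (h : conv P g γ ≠ 0) : ∃ μ, P μ ≠ 0 ∧ g (γ - μ) ≠ 0 := by
  by_contra! hcon
  refine h ?_
  have : ∀ μ, P μ * g (γ - μ) = 0 := fun μ => by
    by_cases hμ : P μ = 0
    · rw [hμ, zero_mul]
    · rw [hcon μ hμ, mul_zero]
  simp [conv, this]

end Conv

/-! ### The functions attached to regular faces -/

section Special

variable {F : Set (Module.Dual ℝ V)} {u : Module.Dual ℝ V} {Y : List Γ}

open Classical in
/-- The terms of the expansion of `P^F`: `k a` for `a` positive on `F`, and `-(k + 1) a` for the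
other vectors. -/
noncomputable def faceWeight (F : Set (Module.Dual ℝ V)) (a : Γ) (k : ℕ) : Γ :=
  (if PosOn F a then (k : ℤ) else -((k : ℤ) + 1)) • a

open Classical in
theorem specialFn_eq (F : Set (Module.Dual ℝ V)) (Y : List Γ) : specialFn F Y = fun γ =>
    (-1) ^ (Y.filter (fun b => ¬PosOn F b)).length * countFn (faceWeight F) Y γ := rfl

theorem isProperWeight_faceWeight (h0 : ∀ a ∈ Y, u (a : V) ≠ 0)
    (hF : ∀ a ∈ Y, PosOn F a ↔ 0 < u (a : V)) : IsProperWeight u (faceWeight F) Y := by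
  intro a ha
  refine ⟨|u (a : V)|, abs_pos.2 (h0 a ha), fun k => ?_⟩
  rcases lt_or_gt_of_ne (h0 a ha) with h | h
  · have hn : ¬PosOn F a := fun hp => h.not_gt ((hF a ha).1 hp)
    rw [abs_of_neg h, faceWeight, if_neg hn, Submodule.coe_smul, map_zsmul, zsmul_eq_mul]
    push_cast
    nlinarith
  · rw [abs_of_pos h, faceWeight, if_pos ((hF a ha).2 h), Submodule.coe_smul, map_zsmul,
      zsmul_eq_mul]
    push_cast
    exact le_rfl

theorem countFn_ne_zero_of_specialFn {γ : Γ} (h : specialFn F Y γ ≠ 0) :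
    countFn (faceWeight F) Y γ ≠ 0 := by
  rw [specialFn_eq] at h
  exact right_ne_zero_of_mul h

/-- `P^F_Y` is the inverse of `∇_Y` for convolution. -/
theorem nablaList_specialFn (h0 : ∀ a ∈ Y, u (a : V) ≠ 0)
    (hF : ∀ a ∈ Y, PosOn F a ↔ 0 < u (a : V)) : nablaList Y (specialFn F Y) = delta := by
  classical
  induction Y with
  | nil =>
    rw [nablaList_nil, specialFn_eq]
    funext γ
    simp [countFn_nil]
  | cons a Y ih =>
    have h0' : ∀ b ∈ Y, u (b : V) ≠ 0 := fun b hb => h0 b (List.mem_cons_of_mem a hb)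
    have hF' : ∀ b ∈ Y, PosOn F b ↔ 0 < u (b : V) := fun b hb =>
      hF b (List.mem_cons_of_mem a hb)
    have hcomm := nablaList_comm Y [a] (specialFn F (a :: Y))
    simp only [nablaList_cons, nablaList_nil] at hcomm
    rw [nablaList_cons, ← hcomm, ← ih h0' hF']
    congr 1
    funext γ
    have hw := isProperWeight_faceWeight h0 hF
    simp only [specialFn_eq, nabla]
    by_cases ha : PosOn F a
    · have h := countFn_cons hw (b := a)
        (fun k => by simp [faceWeight, ha, add_smul, add_comm]) γ
      simp only [faceWeight, if_pos ha, Nat.cast_zero, zero_smul, sub_zero] at h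
      have hl : (List.filter (fun b => ¬PosOn F b) (a :: Y)) =
          List.filter (fun b => ¬PosOn F b) Y := by simp [ha]
      rw [hl, ← mul_sub]
      congr 1
      linarith
    · have h := countFn_cons hw (b := -a) (fun k => by
        simp only [faceWeight, if_neg ha]
        push_cast
        module) (γ - a)
      have e : faceWeight F a 0 = -a := by simp [faceWeight, ha]
      rw [e, sub_neg_eq_add, sub_add_cancel] at h
      have hl : (List.filter (fun b => ¬PosOn F b) (a :: Y)).length =
          (List.filter (fun b => ¬PosOn F b) Y).length + 1 := by simp [ha]
      rw [hl, h]
      ring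

section Slice

variable {H : Submodule ℝ V} {g : Γ → ℤ}

theorem dual_eq_of_supportedOn (hu : u ∈ H.dualAnnihilator) (hg : SupportedOn H g)
    {γ μ : Γ} (h : g (γ - μ) ≠ 0) : u (μ : V) = u (γ : V) := by
  have hm : ((γ - μ : Γ) : V) ∈ H := by
    by_contra hm
    exact h (hg _ hm)
  have := (Submodule.mem_dualAnnihilator u).1 hu _ hm
  simp only [AddSubgroupClass.coe_sub, map_sub] at this
  linarith

theorem convDefined_specialFn (hu : u ∈ H.dualAnnihilator) (hg : SupportedOn H g)
    (h0 : ∀ a ∈ Y, u (a : V) ≠ 0) (hF : ∀ a ∈ Y, PosOn F a ↔ 0 < u (a : V)) :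
    ConvDefined (specialFn F Y) g := by
  intro γ
  refine ((isProperWeight_faceWeight h0 hF).finite_countFn_ne_zero (u (γ : V))).subset ?_
  intro μ hμ
  exact ⟨countFn_ne_zero_of_specialFn (left_ne_zero_of_mul hμ),
    (dual_eq_of_supportedOn hu hg (right_ne_zero_of_mul hμ)).le⟩

theorem nonneg_of_conv_specialFn_ne_zero (hu : u ∈ H.dualAnnihilator) (hg : SupportedOn H g)
    (h0 : ∀ a ∈ Y, u (a : V) ≠ 0) (hF : ∀ a ∈ Y, PosOn F a ↔ 0 < u (a : V))
    {γ : Γ} (h : conv (specialFn F Y) g γ ≠ 0) :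
    0 ≤ u (γ : V) := by
  obtain ⟨μ, hμ, hgμ⟩ := conv_ne_zero h
  rw [← dual_eq_of_supportedOn hu hg hgμ]
  exact (isProperWeight_faceWeight h0 hF).nonneg_of_countFn_ne_zero
    (countFn_ne_zero_of_specialFn hμ)

theorem nablaList_conv_specialFn (hu : u ∈ H.dualAnnihilator) (hg : SupportedOn H g)
    (h0 : ∀ a ∈ Y, u (a : V) ≠ 0) (hF : ∀ a ∈ Y, PosOn F a ↔ 0 < u (a : V)) :
    nablaList Y (conv (specialFn F Y) g) = g := by
  rw [nablaList_conv (convDefined_specialFn hu hg h0 hF), nablaList_specialFn h0 hF, conv_delta]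

end Slice

end Special

/-! ### The wall between two adjacent topes -/

theorem mul_eq_mul_of_ker_le {φ ψ : Module.Dual ℝ V} (h : ∀ x, φ x = 0 → ψ x = 0) (x y : V) :
    φ y * ψ x = φ x * ψ y := by
  have h1 := h (φ y • x - φ x • y) (by
    simp only [map_sub, map_smul, smul_eq_mul]
    ring)
  simpa only [map_sub, map_smul, smul_eq_mul, sub_eq_zero] using h1

theorem pos_of_ker_le {φ ψ : Module.Dual ℝ V} (h : ∀ x, φ x = 0 → ψ x = 0) {x y : V}
    (hφy : 0 < φ y) (hψy : 0 < ψ y) (hψx : 0 < ψ x) : 0 < φ x := by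
  have h1 := mul_eq_mul_of_ker_le h x y
  have h2 : 0 < φ x * ψ y := h1 ▸ mul_pos hφy hψx
  exact (pos_iff_pos_of_mul_pos h2).2 hψy

section Wall

variable [FiniteDimensional ℝ V] {X : List Γ} {τ₁ τ₂ : Set V} {H : Submodule ℝ V}

/-- Adjacent topes lie on different sides of the hyperplane `H`, which is a wall. -/
theorem AdjacentAlong.exists_dual (hτ₁ : IsTope ⊤ X τ₁) (hτ₂ : IsTope ⊤ X τ₂)
    (hH : AdjacentAlong τ₁ τ₂ H) :
    IsWall ⊤ X H ∧ ∃ u : Module.Dual ℝ V, (∀ x, u x = 0 ↔ x ∈ H) ∧ (∀ x ∈ τ₁, 0 < u x) ∧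
      ∀ x ∈ τ₂, u x < 0 := by
  obtain ⟨hspan, hrank⟩ := hH
  obtain ⟨x₁, hx₁⟩ := hτ₁.nonempty
  obtain ⟨x₂, hx₂⟩ := hτ₂.nonempty
  -- some wall separates the two topes: otherwise they coincide, and `H` is the whole space
  obtain ⟨K, hK, u, hu, hpos, hneg⟩ : ∃ K, IsWall ⊤ X K ∧ ∃ u : Module.Dual ℝ V,
      (∀ x, u x = 0 ↔ x ∈ K) ∧ (∀ x ∈ τ₁, 0 < u x) ∧ ∀ x ∈ τ₂, u x < 0 := by
    by_contra! hcon
    have hx₂' : x₂ ∈ τ₁ := by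
      refine hτ₁.mem_of_forall hx₁ trivial fun K hK => ?_
      obtain ⟨φ, hφ, hφpos⟩ := hτ₁.exists_dual_pos hK
      obtain ⟨ψ, hψ, hψpos⟩ := hτ₂.exists_dual_pos hK
      refine ⟨φ, fun k hk => (hφ k trivial).2 hk, hφpos x₁ hx₁, ?_⟩
      obtain ⟨y, hy, hyφ⟩ := hcon K hK φ (fun x => hφ x trivial) hφpos
      have hyK : φ y ≠ 0 := fun h0 =>
        (mem_regularPoints.1 (hτ₂.subset_regularPoints hy)).2 K hK ((hφ y trivial).1 h0)
      have hy0 : 0 < φ y := lt_of_le_of_ne hyφ hyK.symm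
      exact pos_of_ker_le (fun x h => (hψ x trivial).2 ((hφ x trivial).1 h)) hy0
        (hψpos y hy) (hψpos x₂ hx₂)
    have heq : τ₁ = τ₂ :=
      (hτ₁.eq_connectedComponentIn hx₂').trans (hτ₂.eq_connectedComponentIn hx₂).symm
    rw [heq, Set.inter_self] at hspan
    have hsub : ∀ y ∈ τ₂, y ∈ H := fun y hy => by
      rw [← hspan]
      exact Submodule.subset_span (subset_closure hy)
    have htop : H = ⊤ := by
      refine eq_top_iff.2 fun w _ => ?_
      obtain ⟨n, hn⟩ := (hτ₂.eventually_add_nsmul_mem hx₂ (w := w) trivial).exists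
      simpa using H.sub_mem (hsub _ hn) (H.nsmul_mem (hsub _ hx₂) n)
    rw [htop, finrank_top] at hrank
    omega
  have hcont : Continuous u := LinearMap.continuous_of_finiteDimensional u
  have h1 : closure τ₁ ⊆ {x | 0 ≤ u x} :=
    closure_minimal (fun x hx => (hpos x hx).le) (isClosed_le continuous_const hcont)
  have h2 : closure τ₂ ⊆ {x | u x ≤ 0} :=
    closure_minimal (fun x hx => (hneg x hx).le) (isClosed_le hcont continuous_const)
  have hHK : H = K := by
    refine Submodule.eq_of_le_of_finrank_eq ?_ ?_
    · rw [← hspan, Submodule.span_le]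
      exact fun x hx => (hu x).1 (le_antisymm (h2 hx.2) (h1 hx.1))
    · have := hK.2.2
      rw [finrank_top] at this
      omega
  subst hHK
  exact ⟨hK, u, hu, hpos, hneg⟩

theorem exists_mem_outside (hX : listSpan X = ⊤) (hH : IsWall ⊤ X H) : ∃ a, a ∈ outside X H := by
  by_contra! h
  have htop : H = ⊤ := by
    rw [eq_top_iff, ← hX, listSpan_le]
    intro a ha
    by_contra haH
    exact h a (mem_outside.2 ⟨ha, haH⟩)
  have := hH.2.2
  rw [htop] at this
  omega

/-- A wall of `X ∩ H` in `H` is contained in a wall of `X` different from `H`. -/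
theorem IsWall.exists_wall_inside (hX : listSpan X = ⊤) (hH : IsWall ⊤ X H) {K : Submodule ℝ V}
    (hK : IsWall H (inside X H) K) : ∃ K', IsWall ⊤ X K' ∧ K' ≠ H ∧ K ≤ K' := by
  obtain ⟨a, ha⟩ := exists_mem_outside hX hH
  obtain ⟨haX, haH⟩ := mem_outside.1 ha
  refine ⟨K ⊔ Submodule.span ℝ {(a : V)}, ⟨le_top, hK.2.1.of_inside.sup_span haX, ?_⟩, ?_,
    le_sup_left⟩
  · rw [finrank_sup_span_singleton fun h => haH (hK.1 h), hK.2.2]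
    exact hH.2.2
  · intro h
    exact haH (h ▸ Submodule.mem_sup_right (Submodule.mem_span_singleton_self _))

/-- There is a point of `H` lying strictly on the side of both topes for every wall other
than `H`; it can be taken in the relative interior of the common face. -/
theorem AdjacentAlong.exists_interior_point (hτ₁ : IsTope ⊤ X τ₁) (hτ₂ : IsTope ⊤ X τ₂)
    (hH : AdjacentAlong τ₁ τ₂ H) :
    ∃ x₀ ∈ H, (∀ K, IsWall ⊤ X K → K ≠ H → ∃ φ : Module.Dual ℝ V, (∀ x, φ x = 0 ↔ x ∈ K) ∧
        (∀ x ∈ τ₁, 0 < φ x) ∧ (∀ x ∈ τ₂, 0 < φ x) ∧ 0 < φ x₀) ∧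
      ∀ φ : Module.Dual ℝ V, (∀ x ∈ closure τ₁ ∩ closure τ₂, 0 ≤ φ x) → 0 ≤ φ x₀ := by
  obtain ⟨hspan, hrank⟩ := hH
  obtain ⟨t, htC, htspan⟩ : ∃ t : Finset V, (t : Set V) ⊆ closure τ₁ ∩ closure τ₂ ∧
      Submodule.span ℝ (t : Set V) = H := by
    obtain ⟨b, hb, hbspan, hbli⟩ := exists_linearIndependent ℝ (closure τ₁ ∩ closure τ₂)
    have hfin : b.Finite := hbli.setFinite
    exact ⟨hfin.toFinset, by simpa using hb, by simpa [hbspan] using hspan⟩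
  refine ⟨∑ x ∈ t, x, ?_, fun K hK hKH => ?_, fun φ hφ => ?_⟩
  · rw [← htspan]
    exact sum_mem fun x hx => Submodule.subset_span hx
  · obtain ⟨φ, hφ, hpos⟩ := hτ₁.exists_dual_pos hK
    obtain ⟨ψ, hψ, hψpos⟩ := hτ₂.exists_dual_pos hK
    have hcl : ∀ x ∈ closure τ₁, 0 ≤ φ x := closure_minimal (fun x hx => (hpos x hx).le)
      (isClosed_le continuous_const (LinearMap.continuous_of_finiteDimensional φ))
    have hcl' : ∀ x ∈ closure τ₂, 0 ≤ ψ x := closure_minimal (fun x hx => (hψpos x hx).le)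
      (isClosed_le continuous_const (LinearMap.continuous_of_finiteDimensional ψ))
    obtain ⟨y, hyt, hyK⟩ : ∃ y ∈ t, y ∉ K := by
      by_contra! h
      have hHK : H ≤ K := by
        rw [← htspan, Submodule.span_le]
        exact h
      refine hKH (Submodule.eq_of_le_of_finrank_eq hHK ?_).symm
      have := hK.2.2
      rw [finrank_top] at this
      omega
    have hφy : 0 < φ y := lt_of_le_of_ne (hcl y (htC hyt).1) fun h =>
      hyK ((hφ y trivial).1 h.symm)
    have hψy : 0 < ψ y := lt_of_le_of_ne (hcl' y (htC hyt).2) fun h =>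
      hyK ((hψ y trivial).1 h.symm)
    refine ⟨φ, fun x => hφ x trivial, hpos, fun x hx => ?_, ?_⟩
    · exact pos_of_ker_le (fun x h => (hψ x trivial).2 ((hφ x trivial).1 h)) hφy hψy (hψpos x hx)
    · rw [map_sum]
      exact Finset.sum_pos' (fun x hx => hcl x (htC hx).1) ⟨y, hyt, hφy⟩
  · rw [map_sum]
    exact Finset.sum_nonneg fun x hx => hφ x (htC hx)

/-- The common face of two adjacent topes lies in the closure of exactly one tope of `X ∩ H`, and
the following holds for some lattice vector `v` of that tope: adding large multiples of `v` moves
every point that is not on `H` into one of the two adjacent topes. -/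
theorem AdjacentAlong.exists_tope_inside (hX : listSpan X = ⊤) (hτ₁ : IsTope ⊤ X τ₁)
    (hτ₂ : IsTope ⊤ X τ₂) (hH : AdjacentAlong τ₁ τ₂ H) :
    ∃ τ₁₂ : Set V, IsTope H (inside X H) τ₁₂ ∧ closure τ₁ ∩ closure τ₂ ⊆ closure τ₁₂ ∧
      (∀ τ, IsTope H (inside X H) τ → closure τ₁ ∩ closure τ₂ ⊆ closure τ → τ = τ₁₂) ∧
      ∃ v : Γ, (v : V) ∈ τ₁₂ ∧ ∀ u : Module.Dual ℝ V, (∀ x, u x = 0 ↔ x ∈ H) →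
        (∀ x ∈ τ₁, 0 < u x) → (∀ x ∈ τ₂, u x < 0) →
        (∀ w, 0 < u w → ∀ᶠ n : ℕ in Filter.atTop, w + n • (v : V) ∈ τ₁) ∧
        (∀ w, u w < 0 → ∀ᶠ n : ℕ in Filter.atTop, w + n • (v : V) ∈ τ₂) := by
  have hwall := (hH.exists_dual hτ₁ hτ₂).1
  obtain ⟨x₀, hx₀H, hx₀, hx₀C⟩ := hH.exists_interior_point hτ₁ hτ₂
  have hx₀reg : x₀ ∈ regularPoints H (inside X H) := by
    refine mem_regularPoints.2 ⟨hx₀H, fun K hK hx₀K => ?_⟩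
    obtain ⟨K', hK', hne, hKK'⟩ := hwall.exists_wall_inside hX hK
    obtain ⟨φ, hφ, -, -, hφx₀⟩ := hx₀ K' hK' hne
    exact hφx₀.ne' ((hφ x₀).2 (hKK' hx₀K))
  have htope : IsTope H (inside X H) (connectedComponentIn (regularPoints H (inside X H)) x₀) :=
    ⟨x₀, hx₀reg, rfl⟩
  have hx₀mem := mem_connectedComponentIn hx₀reg
  set τ₁₂ := connectedComponentIn (regularPoints H (inside X H)) x₀ with hτ₁₂
  refine ⟨τ₁₂, htope, fun c hc => ?_, fun τ hτ hsub => ?_, ?_⟩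
  · -- `c` is the limit of the points `c + ε x₀` of the tope
    have hcH : c ∈ H := by
      rw [← hH.1]
      exact Submodule.subset_span hc
    have hmem : ∀ n : ℕ, c + (n + 1 : ℝ)⁻¹ • x₀ ∈ τ₁₂ := by
      intro n
      refine htope.mem_of_forall hx₀mem (H.add_mem hcH (H.smul_mem _ hx₀H)) fun K hK => ?_
      obtain ⟨K', hK', hne, hKK'⟩ := hwall.exists_wall_inside hX hK
      obtain ⟨φ, hφ, hφ₁, -, hφx₀⟩ := hx₀ K' hK' hne
      refine ⟨φ, fun k hk => (hφ k).2 (hKK' hk), hφx₀, ?_⟩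
      have hcl : ∀ x ∈ closure τ₁, 0 ≤ φ x := closure_minimal (fun x hx => (hφ₁ x hx).le)
        (isClosed_le continuous_const (LinearMap.continuous_of_finiteDimensional φ))
      have h1 := hcl c hc.1
      have h2 : 0 < (n + 1 : ℝ)⁻¹ * φ x₀ := by positivity
      simp only [map_add, map_smul, smul_eq_mul]
      linarith
    refine mem_closure_of_tendsto (f := fun n : ℕ => c + (n + 1 : ℝ)⁻¹ • x₀) (b := Filter.atTop)
      ?_ (Filter.Eventually.of_forall hmem)
    have h1 : Filter.Tendsto (fun n : ℕ => ((n : ℝ) + 1)⁻¹) Filter.atTop (nhds 0) := by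
      simpa using tendsto_one_div_add_atTop_nhds_zero_nat (𝕜 := ℝ)
    simpa using tendsto_const_nhds.add (h1.smul_const x₀)
  · have hx₀τ : x₀ ∈ τ := by
      obtain ⟨y, hy⟩ := hτ.nonempty
      refine hτ.mem_of_forall hy hx₀H fun K hK => ?_
      obtain ⟨φ, hφ, hpos⟩ := hτ.exists_dual_pos hK
      refine ⟨φ, fun k hk => (hφ k (hK.1 hk)).2 hk, hpos y hy, lt_of_le_of_ne ?_ fun h => ?_⟩
      · refine hx₀C φ fun c hc => ?_
        exact closure_minimal (t := {x | 0 ≤ φ x}) (fun x hx => (hpos x hx).le)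
          (isClosed_le continuous_const (LinearMap.continuous_of_finiteDimensional φ)) (hsub hc)
      · exact (mem_regularPoints.1 hx₀reg).2 K hK ((hφ x₀ hx₀H).1 h.symm)
    exact hτ.eq_connectedComponentIn hx₀τ
  · choose! φ hφ hφ₁ hφ₂ hφx₀ using fun (K : Submodule ℝ V) (h : IsWall ⊤ X K ∧ K ≠ H) =>
      hx₀ K h.1 h.2
    have hfin : {K | IsWall ⊤ X K ∧ K ≠ H}.Finite :=
      (finite_isWall ⊤ X).subset fun _ h => h.1
    obtain ⟨U, hU, hUτ⟩ := htope.exists_nhds hx₀mem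
    have hU' : U ∩ ⋂ K ∈ {K | IsWall ⊤ X K ∧ K ≠ H}, {y | 0 < φ K y} ∈ nhds x₀ :=
      Filter.inter_mem hU ((Filter.biInter_mem hfin).2 fun K hK =>
        (isOpen_lt continuous_const
          (LinearMap.continuous_of_finiteDimensional (φ K))).mem_nhds (hφx₀ K hK))
    obtain ⟨S, -, hS⟩ := hwall.2.1
    obtain ⟨n, hn, v, hv, hvU⟩ := exists_latticeIn_smul_mem hS hx₀H hU'
    have hn' : (0 : ℝ) < n := by exact_mod_cast hn
    have hvφ : ∀ K, IsWall ⊤ X K ∧ K ≠ H → 0 < φ K (v : V) := fun K hK => by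
      have h := Set.mem_iInter₂.1 hvU.2 K hK
      simp only [Set.mem_ofPred_eq, map_smul, smul_eq_mul] at h
      exact (pos_iff_pos_of_mul_pos h).1 (by positivity)
    refine ⟨v, ?_, fun u hu hu₁ hu₂ => ⟨fun w hw => ?_, fun w hw => ?_⟩⟩
    · have := htope.smul_mem (hUτ ⟨hvU.1, H.smul_mem _ hv⟩) hn'
      rwa [smul_inv_smul₀ hn'.ne'] at this
    · obtain ⟨x, hx⟩ := hτ₁.nonempty
      have hev : ∀ᶠ n : ℕ in Filter.atTop, ∀ K ∈ {K | IsWall ⊤ X K ∧ K ≠ H},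
          0 < φ K (w + n • (v : V)) :=
        (Filter.eventually_all_finite hfin).2 fun K hK => eventually_pos_add_nsmul w (hvφ K hK)
      filter_upwards [hev] with n hn
      refine hτ₁.mem_of_forall hx trivial fun K hK => ?_
      by_cases hKH : K = H
      · subst hKH
        refine ⟨u, fun k hk => (hu k).2 hk, hu₁ x hx, ?_⟩
        rw [map_add, map_nsmul, (hu v).2 hv]
        simpa using hw
      · exact ⟨φ K, fun k hk => (hφ K ⟨hK, hKH⟩ k).2 hk, hφ₁ K ⟨hK, hKH⟩ x hx, hn K ⟨hK, hKH⟩⟩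
    · obtain ⟨x, hx⟩ := hτ₂.nonempty
      have hev : ∀ᶠ n : ℕ in Filter.atTop, ∀ K ∈ {K | IsWall ⊤ X K ∧ K ≠ H},
          0 < φ K (w + n • (v : V)) :=
        (Filter.eventually_all_finite hfin).2 fun K hK => eventually_pos_add_nsmul w (hvφ K hK)
      filter_upwards [hev] with n hn
      refine hτ₂.mem_of_forall hx trivial fun K hK => ?_
      by_cases hKH : K = H
      · subst hKH
        refine ⟨-u, fun k hk => by simpa using (hu k).2 hk, by simpa using hu₂ x hx, ?_⟩
        rw [LinearMap.neg_apply, map_add, map_nsmul, (hu v).2 hv]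
        simpa using hw
      · exact ⟨φ K, fun k hk => (hφ K ⟨hK, hKH⟩ k).2 hk, hφ₂ K ⟨hK, hKH⟩ x hx, hn K ⟨hK, hKH⟩⟩

end Wall

/-! ### The two half-lines of linear forms vanishing on the wall -/

section Face

variable {X : List Γ} {H : Submodule ℝ V} {F : Set (Module.Dual ℝ V)}

theorem IsRegularFace.ne_zero (hF : IsRegularFace X H F) {u : Module.Dual ℝ V} (hu : u ∈ F)
    {a : Γ} (ha : a ∈ outside X H) : u (a : V) ≠ 0 := by
  obtain ⟨u₀, -, -, rfl⟩ := hF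
  exact right_ne_zero_of_mul (hu.2 a ha).ne'

theorem IsRegularFace.mem_dualAnnihilator (hF : IsRegularFace X H F) {u : Module.Dual ℝ V}
    (hu : u ∈ F) : u ∈ H.dualAnnihilator := by
  obtain ⟨u₀, -, -, rfl⟩ := hF
  exact hu.1

theorem IsRegularFace.nonempty (hF : IsRegularFace X H F) : F.Nonempty := by
  obtain ⟨u, hu, hu0, rfl⟩ := hF
  exact ⟨u, hu, fun a ha => mul_self_pos.2 (hu0 a ha)⟩

theorem IsRegularFace.posOn_iff (hF : IsRegularFace X H F) {u : Module.Dual ℝ V} (hu : u ∈ F)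
    {a : Γ} (ha : a ∈ outside X H) : PosOn F a ↔ 0 < u (a : V) := by
  refine ⟨fun h => h u hu, fun h v hv => ?_⟩
  obtain ⟨u₀, -, -, rfl⟩ := hF
  have h1 := (pos_iff_pos_of_mul_pos (hu.2 a ha)).2 h
  exact (pos_iff_pos_of_mul_pos (hv.2 a ha)).1 h1

theorem IsRegularFace.neg (hF : IsRegularFace X H F) : IsRegularFace X H (-F) := by
  obtain ⟨u, hu, hu0, rfl⟩ := hF
  refine ⟨-u, neg_mem hu, fun a ha => by simpa using hu0 a ha, ?_⟩
  ext v
  simp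

/-- The set of forms vanishing on the hyperplane `H` with the same signs as `u` is determined by
the positivity on a point outside `H`. -/
theorem IsRegularFace.eq_of_pos {F' : Set (Module.Dual ℝ V)} {w : Module.Dual ℝ V}
    (hw : ∀ x, w x = 0 ↔ x ∈ H) (hF : IsRegularFace X H F) (hF' : IsRegularFace X H F') {x : V}
    (hx : ∀ u ∈ F, 0 < u x) (hx' : ∀ u ∈ F', 0 < u x) : F = F' := by
  have key : ∀ {F F' : Set (Module.Dual ℝ V)}, IsRegularFace X H F → IsRegularFace X H F' →
      (∀ u ∈ F, 0 < u x) → (∀ u ∈ F', 0 < u x) → F ⊆ F' := by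
    intro F F' hF hF' hx hx' v hv
    obtain ⟨u', hu'⟩ := hF'.nonempty
    have hu'x := hx' u' hu'
    have hvx := hx v hv
    have hvH := hF.mem_dualAnnihilator hv
    have hu'H := hF'.mem_dualAnnihilator hu'
    have hker : ∀ y, u' y = 0 → v y = 0 := by
      intro y hy
      have h1 := mul_eq_mul_of_ker_le (φ := w) (ψ := u')
        (fun z hz => (Submodule.mem_dualAnnihilator u').1 hu'H z ((hw z).1 hz)) y x
      rw [hy, mul_zero] at h1
      have hwy := (mul_eq_zero.1 h1.symm).resolve_right hu'x.ne'
      exact (Submodule.mem_dualAnnihilator v).1 hvH y ((hw y).1 hwy)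
    have hne : ∀ a ∈ outside X H, 0 < u' (a : V) * v (a : V) := by
      intro a ha
      have h1 := mul_eq_mul_of_ker_le hker (a : V) x
      have h2 := hF'.ne_zero hu' ha
      have h3 : 0 < u' x * (u' (a : V) * v (a : V)) := by
        have h4 : u' x * (u' (a : V) * v (a : V)) = u' (a : V) ^ 2 * v x := by
          linear_combination u' (a : V) * h1
        rw [h4]
        positivity
      exact (pos_iff_pos_of_mul_pos h3).1 hu'x
    obtain ⟨u₀, -, -, rfl⟩ := hF'
    refine ⟨hvH, fun a ha => ?_⟩
    have h1 := hu'.2 a ha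
    have h2 := hne a ha
    have h3 : 0 < u' (a : V) ^ 2 := sq_pos_of_ne_zero (left_ne_zero_of_mul h2.ne')
    have h4 : u' (a : V) ^ 2 * (u₀ (a : V) * v (a : V)) =
      (u₀ (a : V) * u' (a : V)) * (u' (a : V) * v (a : V)) := by ring
    exact (pos_iff_pos_of_mul_pos (h4 ▸ mul_pos h1 h2)).1 h3
  exact (key hF hF' hx hx').antisymm (key hF' hF hx' hx)

end Face

/-! ### The wall crossing formula -/

section Propagation

variable {φ : Module.Dual ℝ V} {v : Γ}

/-- If `∇_a h` vanishes far out on all the rays in direction `v`, and `h` does so on the rays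
contained in a half-space `φ < c`, then `h` does so on all rays. -/
theorem eventually_eq_zero_of_nabla {a : Γ} (ha : φ (a : V) ≠ 0) {h : Γ → ℤ} {c : ℝ}
    (hc : ∀ γ : Γ, φ (γ : V) < c → ∀ᶠ n : ℕ in Filter.atTop, h (γ + n • v) = 0)
    (hn : ∀ γ : Γ, ∀ᶠ n : ℕ in Filter.atTop, nabla a h (γ + n • v) = 0) (γ : Γ) :
    ∀ᶠ n : ℕ in Filter.atTop, h (γ + n • v) = 0 := by
  have hstep : ∀ γ : Γ, (∀ᶠ n : ℕ in Filter.atTop, h (γ - a + n • v) = 0) ↔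
      ∀ᶠ n : ℕ in Filter.atTop, h (γ + n • v) = 0 := by
    intro γ
    have e : ∀ n : ℕ, γ - a + n • v = γ + n • v - a := fun n => by abel
    constructor <;> intro h1 <;> filter_upwards [h1, hn γ] with n h2 h3
    · rw [e] at h2
      simp only [nabla] at h3
      omega
    · rw [e]
      simp only [nabla] at h3
      omega
  have hnat : ∀ (m : ℕ) (γ : Γ), (∀ᶠ n : ℕ in Filter.atTop, h (γ - m • a + n • v) = 0) ↔
      ∀ᶠ n : ℕ in Filter.atTop, h (γ + n • v) = 0 := by
    intro m
    induction m with
    | zero => simp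
    | succ m ih =>
      intro γ
      rw [succ_nsmul, ← sub_sub, hstep, ih]
  rcases lt_or_gt_of_ne ha with hneg | hpos
  · obtain ⟨m, hm⟩ := exists_nat_gt ((φ (γ : V) - c) / (-φ (a : V)))
    rw [div_lt_iff₀ (by linarith)] at hm
    have h1 := (hnat m (γ + m • a)).1
    rw [add_sub_cancel_right] at h1
    refine (hnat m (γ + m • a)).2 (hc _ ?_) |>.mono fun n hn => by
      rwa [add_sub_cancel_right] at hn
    simp
    linarith
  · obtain ⟨m, hm⟩ := exists_nat_gt ((φ (γ : V) - c) / (φ (a : V)))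
    rw [div_lt_iff₀ hpos] at hm
    refine (hnat m γ).1 (hc _ ?_)
    simp
    linarith

theorem eventually_eq_zero_of_nablaList {Z : List Γ} (hZ : ∀ a ∈ Z, φ (a : V) ≠ 0) {h : Γ → ℤ}
    {c : ℝ} (hc : ∀ γ : Γ, φ (γ : V) < c → ∀ᶠ n : ℕ in Filter.atTop, h (γ + n • v) = 0)
    (hn : ∀ γ : Γ, ∀ᶠ n : ℕ in Filter.atTop, nablaList Z h (γ + n • v) = 0) (γ : Γ) :
    ∀ᶠ n : ℕ in Filter.atTop, h (γ + n • v) = 0 := by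
  induction Z generalizing h c γ with
  | nil => exact hn γ
  | cons a Z ih =>
    have hcomm := nablaList_comm Z [a] h
    simp only [nablaList_cons, nablaList_nil] at hcomm
    have hZ' : ∀ b ∈ Z, φ (b : V) ≠ 0 := fun b hb => hZ b (List.mem_cons_of_mem a hb)
    refine eventually_eq_zero_of_nabla (hZ a List.mem_cons_self) hc (fun γ' => ?_) γ
    refine ih hZ' (h := nabla a h) (c := min c (c + φ (a : V))) (fun γ'' hγ'' => ?_)
      (fun γ'' => ?_) γ'
    · have h1 := hc γ'' (hγ''.trans_le (min_le_left _ _))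
      have h2 := hc (γ'' - a) (by
        have := hγ''.trans_le (min_le_right _ _)
        simp
        linarith)
      filter_upwards [h1, h2] with n h3 h4
      have e : γ'' - a + n • v = γ'' + n • v - a := by abel
      rw [e] at h4
      simp [nabla, h3, h4]
    · rw [hcomm]
      exact hn γ''

end Propagation

section Main

variable [FiniteDimensional ℝ V] [DiscreteTopology Γ] {X : List Γ} {τ₁ τ₂ τ₁₂ : Set V}
  {H : Submodule ℝ V} {F : Set (Module.Dual ℝ V)}

/-- The difference of the two expansions, convolved with a Dahmen–Micchelli function on the wall,
is a Dahmen–Micchelli function. -/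
theorem conv_sub_conv_mem_spaceDM (hX : listSpan X = ⊤) (hH : IsWall ⊤ X H)
    (hF : IsRegularFace X H F) {g : Γ → ℤ} (hg : g ∈ spaceDM (inside X H)) :
    conv (specialFn F (outside X H)) g - conv (specialFn (-F) (outside X H)) g ∈ spaceDM X := by
  have hgH : SupportedOn H g := by
    have := hg.1
    rwa [hH.2.1.listSpan_inside] at this
  have key : ∀ {F : Set (Module.Dual ℝ V)}, IsRegularFace X H F →
      nablaList (outside X H) (conv (specialFn F (outside X H)) g) = g ∧
      ∀ r : Submodule ℝ V, ¬H ≤ r →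
        nablaList (outside X r) (conv (specialFn F (outside X H)) g) = 0 := by
    intro F hF
    obtain ⟨u, hu⟩ := hF.nonempty
    have huH := hF.mem_dualAnnihilator hu
    have h0 : ∀ a ∈ outside X H, u (a : V) ≠ 0 := fun a ha => hF.ne_zero hu ha
    have hpos : ∀ a ∈ outside X H, PosOn F a ↔ 0 < u (a : V) := fun a ha => hF.posOn_iff hu ha
    have hinv := nablaList_conv_specialFn huH hgH h0 hpos
    refine ⟨hinv, fun r hr => ?_⟩
    have hbdd : BddBelowAlong u (conv (specialFn F (outside X H)) g) :=
      ⟨0, fun γ hγ => nonneg_of_conv_specialFn_ne_zero huH hgH h0 hpos hγ⟩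
    refine (hbdd.nablaList _).eq_zero_of_nablaList_eq_zero h0 ?_
    rw [nablaList_comm, hinv, nablaList_outside_eq_zero hH.2.1 hg hr]
  refine ⟨?_, fun r hr hne => ?_⟩
  · rw [hX]
    exact fun γ hγ => absurd trivial hγ
  · rw [nablaList_sub]
    by_cases hHr : H ≤ r
    · have hrH : H = r := by
        refine Submodule.eq_of_le_of_finrank_le hHr ?_
        have h1 := Submodule.finrank_lt (hX ▸ hne)
        have h2 := hH.2.2
        rw [finrank_top] at h2
        omega
      subst hrH
      rw [(key hF).1, (key hF.neg).1, sub_self]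
    · rw [(key hF).2 r hHr, (key hF.neg).2 r hHr, sub_self]

/-- The wall crossing formula, with the convolution written as a difference of two. -/
theorem localPart_sub_localPart (hX : listSpan X = ⊤) (hτ₁ : IsTope ⊤ X τ₁)
    (hτ₂ : IsTope ⊤ X τ₂) (hH : AdjacentAlong τ₁ τ₂ H) (hτ₁₂ : IsTope H (inside X H) τ₁₂)
    (hsub : closure τ₁ ∩ closure τ₂ ⊆ closure τ₁₂) (hF : IsRegularFace X H F)
    (hFpos : ∀ u ∈ F, ∀ x ∈ τ₁, 0 < u x) {f : Γ → ℤ} (hf : f ∈ spaceF X) :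
    localPart ⊤ X τ₁ f - localPart ⊤ X τ₂ f =
      conv (specialFn F (outside X H))
          (localPart H (inside X H) τ₁₂ (nablaList (outside X H) f)) -
        conv (specialFn (-F) (outside X H))
          (localPart H (inside X H) τ₁₂ (nablaList (outside X H) f)) := by
  obtain ⟨hwall, w, hw, hw₁, hw₂⟩ := hH.exists_dual hτ₁ hτ₂
  obtain ⟨τ', hτ', -, huniq, v, hvτ', hv⟩ := hH.exists_tope_inside hX hτ₁ hτ₂
  obtain rfl := huniq τ₁₂ hτ₁₂ hsub
  clear huniq hτ'
  -- a form `u ∈ F` is a positive multiple of `w`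
  obtain ⟨u, huF⟩ := hF.nonempty
  have huH := hF.mem_dualAnnihilator huF
  have hu₁ := hFpos u huF
  have hwu : ∀ x, w x = 0 → u x = 0 := fun x hx =>
    (Submodule.mem_dualAnnihilator u).1 huH x ((hw x).1 hx)
  obtain ⟨x₁, hx₁⟩ := hτ₁.nonempty
  have hker : ∀ x, u x = 0 ↔ x ∈ H := by
    refine fun x => ⟨fun hx => (hw x).1 ?_, fun hx => hwu x ((hw x).2 hx)⟩
    have h1 := mul_eq_mul_of_ker_le hwu x x₁
    rw [hx, mul_zero] at h1
    exact (mul_eq_zero.1 h1.symm).resolve_right (hu₁ x₁ hx₁).ne'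
  have hu₂ : ∀ x ∈ τ₂, u x < 0 := fun x hx => by
    have h1 := pos_of_ker_le (φ := -u) (ψ := -w) (x := x) (y := -x₁)
      (fun z hz => by
        rw [LinearMap.neg_apply, neg_eq_zero] at hz ⊢
        exact (hw z).2 ((hker z).1 hz))
      (by simpa using hu₁ x₁ hx₁) (by simpa using hw₁ x₁ hx₁) (by simpa using hw₂ x hx)
    simpa using h1
  obtain ⟨hv₁, hv₂⟩ := hv u hker hu₁ hu₂
  have hvH : (v : V) ∈ H := hτ₁₂.subset hvτ'
  have h0 : ∀ a ∈ outside X H, u (a : V) ≠ 0 := fun a ha => hF.ne_zero huF ha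
  have hpos : ∀ a ∈ outside X H, PosOn F a ↔ 0 < u (a : V) := fun a ha => hF.posOn_iff huF ha
  have huF' : -u ∈ -F := by simpa using huF
  have h0' : ∀ a ∈ outside X H, (-u) (a : V) ≠ 0 := fun a ha => hF.neg.ne_zero huF' ha
  have hpos' : ∀ a ∈ outside X H, PosOn (-F) a ↔ 0 < (-u) (a : V) := fun a ha =>
    hF.neg.posOn_iff huF' ha
  have huH' : -u ∈ H.dualAnnihilator := neg_mem huH
  -- the local parts are Dahmen–Micchelli functions that agree with `f` on the topes
  have hτ₁' : IsTope (listSpan X) X τ₁ := by rwa [hX]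
  have hτ₂' : IsTope (listSpan X) X τ₂ := by rwa [hX]
  have hHin := hwall.2.1.listSpan_inside
  have hτ₁₂' : IsTope (listSpan (inside X H)) (inside X H) τ₁₂ := by rwa [hHin]
  have hfH := nablaList_outside_mem_spaceF hwall.2.1 hf
  have hq₁ := localPart_mem_spaceDM hτ₁' hf
  have hq₂ := localPart_mem_spaceDM hτ₂' hf
  have hgDM := localPart_mem_spaceDM hτ₁₂' hfH
  have hq₁f := fun γ hγ => localPart_apply hτ₁' hf (γ := γ) hγ
  have hq₂f := fun γ hγ => localPart_apply hτ₂' hf (γ := γ) hγ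
  have hgf := fun γ hγ => localPart_apply hτ₁₂' hfH (γ := γ) hγ
  rw [hX] at hq₁ hq₂ hq₁f hq₂f
  rw [hHin] at hgDM hgf
  set q₁ := localPart ⊤ X τ₁ f
  set q₂ := localPart ⊤ X τ₂ f
  set g := localPart H (inside X H) τ₁₂ (nablaList (outside X H) f)
  set P := conv (specialFn F (outside X H)) g with hP
  set P' := conv (specialFn (-F) (outside X H)) g with hP'
  have hgH : SupportedOn H g := by
    have := hgDM.1
    rwa [hHin] at this
  have huv : ∀ (γ : Γ) (n : ℕ), u ((γ + n • v : Γ) : V) = u (γ : V) := fun γ n => by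
    simp [(hker v).2 hvH]
  -- `P` vanishes on the side of `τ₂`, and `P'` on the side of `τ₁`
  have hPneg : ∀ γ : Γ, u (γ : V) < 0 → P γ = 0 := fun γ hγ => by
    by_contra h
    exact hγ.not_ge (nonneg_of_conv_specialFn_ne_zero huH hgH h0 hpos h)
  have hP'pos : ∀ γ : Γ, 0 < u (γ : V) → P' γ = 0 := fun γ hγ => by
    by_contra h
    have := nonneg_of_conv_specialFn_ne_zero huH' hgH h0' hpos' h
    rw [LinearMap.neg_apply] at this
    linarith
  -- `f - q₂ - P` vanishes far out on all the rays parallel to the wall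
  have hh : ∀ γ : Γ, ∀ᶠ n : ℕ in Filter.atTop, (f - q₂ - P) (γ + n • v) = 0 := by
    refine eventually_eq_zero_of_nablaList h0 (c := 0) (fun γ hγ => ?_) fun γ => ?_
    · filter_upwards [hv₂ γ hγ] with n hn
      simp only [Pi.sub_apply]
      rw [hq₂f _ hn, hPneg _ (by rwa [huv]), sub_self, sub_zero]
    · have hne : H ≠ listSpan X := by
        rw [hX]
        rintro rfl
        have := hwall.2.2
        omega
      rw [nablaList_sub, nablaList_sub, hq₂.2 H hwall.2.1 hne, hP,
        nablaList_conv_specialFn huH hgH h0 hpos, sub_zero]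
      by_cases hγ : (γ : V) ∈ H
      · filter_upwards [hτ₁₂.eventually_add_nsmul_mem hvτ' hγ] with n hn
        rw [Pi.sub_apply, hgf _ hn, sub_self]
      · refine Filter.Eventually.of_forall fun n => ?_
        have hn : ((γ + n • v : Γ) : V) ∉ H := by
          rwa [← hker, huv, hker]
        rw [Pi.sub_apply, hf H hwall.2.1 _ hn, hgH _ hn, sub_self]
  have hquasi : IsQuasiPolynomialOn ⊤ (q₁ - q₂) := by
    rw [← hX]
    exact spaceDM_isQuasiPolynomialOn (spaceDM_sub hq₁ hq₂)
  have hquasi' : IsQuasiPolynomialOn ⊤ (P - P') := by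
    rw [← hX]
    exact spaceDM_isQuasiPolynomialOn (conv_sub_conv_mem_spaceDM hX hwall hF hgDM)
  have hside : ∀ γ : Γ, 0 < u (γ : V) → (q₁ - q₂) γ = (P - P') γ := by
    intro γ hγ
    refine hquasi.eq_of_eventually_eq hquasi' trivial (v := v) trivial ?_
    filter_upwards [hv₁ γ hγ, hh γ] with n hn hhn
    simp only [Pi.sub_apply] at hhn ⊢
    rw [hq₁f _ hn, hP'pos _ (by rwa [huv])]
    linarith
  obtain ⟨v₁, hv₁τ⟩ := hτ₁'.exists_lattice_mem
  funext γ
  refine hquasi.eq_of_eventually_eq hquasi' trivial (v := v₁) trivial ?_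
  filter_upwards [eventually_pos_add_nsmul (γ : V) (hu₁ v₁ hv₁τ)] with n hn
  exact hside _ hn

end Main

end WallCrossing

open WallCrossing
theorem theorem3p11 {V : Type*} [NormedAddCommGroup V] [NormedSpace ℝ V] [FiniteDimensional ℝ V]
    (Γ : Submodule ℤ V) [DiscreteTopology Γ] [IsZLattice ℝ Γ]
    (X : List Γ) (hX0 : ∀ a ∈ X, a ≠ 0)
    (hXspan : Submodule.span ℝ {v : V | ∃ a ∈ X, (a : V) = v} = ⊤)
    (τ₁ τ₂ : Set V) (hτ₁ : IsTope ⊤ X τ₁) (hτ₂ : IsTope ⊤ X τ₂)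
    (H : Submodule ℝ V) (hH : AdjacentAlong τ₁ τ₂ H) :
    -- the objects entering the formula are well defined
    IsRational X H ∧
    (∃! τ₁₂ : Set V, IsTope H (inside X H) τ₁₂ ∧ closure τ₁ ∩ closure τ₂ ⊆ closure τ₁₂) ∧
    (∃! F : Set (Module.Dual ℝ V), IsRegularFace X H F ∧ ∀ u ∈ F, ∀ x ∈ τ₁, 0 < u x) ∧
    ∀ (τ₁₂ : Set V) (F : Set (Module.Dual ℝ V)),
      IsTope H (inside X H) τ₁₂ → closure τ₁ ∩ closure τ₂ ⊆ closure τ₁₂ →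
      IsRegularFace X H F → (∀ u ∈ F, ∀ x ∈ τ₁, 0 < u x) →
      -- the wall crossing formula
      (∀ f ∈ spaceF X,
        (∃! q, IsLocalPart ⊤ X τ₁ f q) ∧
        (∃! q, IsLocalPart ⊤ X τ₂ f q) ∧
        (∃! q, IsLocalPart H (inside X H) τ₁₂ (nablaList (outside X H) f) q) ∧
        ConvDefined (specialFn F (outside X H))
          (localPart H (inside X H) τ₁₂ (nablaList (outside X H) f)) ∧
        ConvDefined (specialFn (-F) (outside X H))
          (localPart H (inside X H) τ₁₂ (nablaList (outside X H) f)) ∧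
        localPart ⊤ X τ₁ f - localPart ⊤ X τ₂ f =
          conv (specialFn F (outside X H) - specialFn (-F) (outside X H))
            (localPart H (inside X H) τ₁₂ (nablaList (outside X H) f))) ∧
      -- the case of the partition function
      (HasPointedCone X →
        partitionFn X ∈ spaceF X ∧
        nablaList (outside X H) (partitionFn X) = partitionFn (inside X H) ∧
        localPart ⊤ X τ₁ (partitionFn X) - localPart ⊤ X τ₂ (partitionFn X) =
          conv (specialFn F (outside X H) - specialFn (-F) (outside X H))
            (localPart H (inside X H) τ₁₂ (partitionFn (inside X H)))) := by
  have hX : listSpan X = ⊤ := hXspan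
  obtain ⟨hwall, w, hw, hw₁, hw₂⟩ := hH.exists_dual hτ₁ hτ₂
  have hrat := hwall.2.1
  obtain ⟨x₁, hx₁⟩ := hτ₁.nonempty
  refine ⟨hrat, ?_, ?_, fun τ₁₂ F hτ₁₂ hsub hF hFpos => ?_⟩
  · obtain ⟨τ₁₂, hτ₁₂, hsub, huniq, -⟩ := hH.exists_tope_inside hX hτ₁ hτ₂
    exact ⟨τ₁₂, ⟨hτ₁₂, hsub⟩, fun τ hτ => huniq τ hτ.1 hτ.2⟩
  · have hF : IsRegularFace X H {v | v ∈ H.dualAnnihilator ∧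
        ∀ a ∈ outside X H, 0 < w (a : V) * v (a : V)} :=
      ⟨w, (Submodule.mem_dualAnnihilator w).2 fun x hx => (hw x).2 hx,
        fun a ha h => (mem_outside.1 ha).2 ((hw _).1 h), rfl⟩
    have hFpos : ∀ u ∈ {v | v ∈ H.dualAnnihilator ∧
        ∀ a ∈ outside X H, 0 < w (a : V) * v (a : V)}, ∀ x ∈ τ₁, 0 < u x := by
      rintro u ⟨huH, hu⟩ x hx
      obtain ⟨a, ha⟩ := exists_mem_outside hX hwall
      have h1 := mul_eq_mul_of_ker_le (φ := w) (ψ := u) (fun y hy =>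
        (Submodule.mem_dualAnnihilator u).1 huH y ((hw y).1 hy)) x (a : V)
      have h2 := hu a ha
      have h3 : w (a : V) ^ 2 * u x = w x * (w (a : V) * u (a : V)) := by
        linear_combination w (a : V) * h1
      have h4 : 0 < w (a : V) ^ 2 := sq_pos_of_ne_zero (left_ne_zero_of_mul h2.ne')
      exact (pos_iff_pos_of_mul_pos (h3 ▸ mul_pos (hw₁ x hx) h2)).1 h4
    exact ⟨_, ⟨hF, hFpos⟩, fun F' hF' => hF'.1.eq_of_pos hw hF
      (fun u hu => hF'.2 u hu x₁ hx₁) fun u hu => hFpos u hu x₁ hx₁⟩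
  · obtain ⟨u, huF⟩ := hF.nonempty
    have huF' : -u ∈ -F := by simpa using huF
    have hformula : ∀ f ∈ spaceF X,
        (∃! q, IsLocalPart ⊤ X τ₁ f q) ∧
        (∃! q, IsLocalPart ⊤ X τ₂ f q) ∧
        (∃! q, IsLocalPart H (inside X H) τ₁₂ (nablaList (outside X H) f) q) ∧
        ConvDefined (specialFn F (outside X H))
          (localPart H (inside X H) τ₁₂ (nablaList (outside X H) f)) ∧
        ConvDefined (specialFn (-F) (outside X H))
          (localPart H (inside X H) τ₁₂ (nablaList (outside X H) f)) ∧
        localPart ⊤ X τ₁ f - localPart ⊤ X τ₂ f =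
          conv (specialFn F (outside X H) - specialFn (-F) (outside X H))
            (localPart H (inside X H) τ₁₂ (nablaList (outside X H) f)) := by
      intro f hf
      have hfH := nablaList_outside_mem_spaceF hrat hf
      have hex₁ := existsUnique_isLocalPart (by rwa [hX]) hf (τ := τ₁)
      have hex₂ := existsUnique_isLocalPart (by rwa [hX]) hf (τ := τ₂)
      have hex := existsUnique_isLocalPart (by rwa [hrat.listSpan_inside]) hfH (τ := τ₁₂)
      have hloc := localPart_isLocalPart (by rwa [hrat.listSpan_inside]) hfH (τ := τ₁₂)
      rw [hX] at hex₁ hex₂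
      rw [hrat.listSpan_inside] at hex hloc
      have hc := convDefined_specialFn (hF.mem_dualAnnihilator huF) hloc.1
        (fun a ha => hF.ne_zero huF ha) fun a ha => hF.posOn_iff huF ha
      have hc' := convDefined_specialFn (hF.neg.mem_dualAnnihilator huF') hloc.1
        (fun a ha => hF.neg.ne_zero huF' ha) fun a ha => hF.neg.posOn_iff huF' ha
      refine ⟨hex₁, hex₂, hex, hc, hc', ?_⟩
      rw [conv_sub hc hc']
      exact localPart_sub_localPart hX hτ₁ hτ₂ hH hτ₁₂ hsub hF hFpos hf
    refine ⟨hformula, fun hpointed => ?_⟩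
    obtain ⟨l, hl⟩ := hpointed.exists_dual_pos hX0
    have hmem := partitionFn_mem_spaceF hl
    have hnabla := nablaList_outside_partitionFn hl H
    have h := (hformula _ hmem).2.2.2.2.2
    rw [hnabla] at h
    exact ⟨hmem, hnabla, h⟩
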